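/- A finite simple graph, or a finite directed graph without parallel arcs, is given to an algorithm as a bit string: the number $n$ of vertices in unary, followed by the adjacency matrix. An \emph{oriented graph} is a directed graph without loops and without directed $2$-cycles; an \emph{oriented clique} is an oriented graph in which any two distinct non-adjacent vertices are the ends of a directed path of length $2$ (in one of the two directions). Let OCLIQUEISO be the problem whose instances are the pairs of finite oriented cliques $G,H$ and whose question is whether $G\cong H$, and let DAGISO be the same problem for pairs of finite directed acyclic graphs. A decision problem is \emph{GI-complete} if it is polynomial-time equivalent to graph isomorphism, that is, if it is polynomial-time many-one reducible to the graph isomorphism problem for finite simple graphs and the latter is polynomial-time many-one reducible to it. \textbf{Theorem.} OCLIQUEISO is GI-complete. Moreover, DAGISO reduces to OCLIQUEISO as follows. For every $n\ge 0$ fix a regular tournament $T_n$ on $2n+1$ vertices. For a directed acyclic graph $G$ with vertices $u_1,\dots,u_n$, let $G^\star$ be the directed graph formed from the disjoint union of two copies $G^L$, $G^R$ of $G$ (with vertices $u_i^L$ and $u_i^R$) and $T_n$ by adding the arcs $u_i^Lu_i^R$ for all $i$, $u_j^Ru_k^L$ for all $j\ne k$, and $u_i^Lt$ and $tu_i^R$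 for all $i$ and all $t\in V(T_n)$. Then: (a) for every choice of the tournaments $T_n$ and all finite directed acyclic graphs $G,H$, both $G^\star$ and $H^\star$ are oriented cliques, and $G\cong H$ if and only if $G^\star\cong H^\star$; (b) for a suitable choice of the tournaments $T_n$, the map $(G,H)\mapsto(G^\star,H^\star)$ (with the vertices of $G^\star$ numbered in the order $u_1^L,\dots,u_n^L$, $u_1^R,\dots,u_n^R$, $V(T_n)$) is a polynomial-time many-one reduction of DAGISO to OCLIQUEISO. -/

import Mathlib

namespace OCliqueGI

/-! ### Directed graphs -/

/-- `G` and `H` are isomorphic as directed graphs. -/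
def DigraphIso {V W : Type} (G : Digraph V) (H : Digraph W) : Prop :=
  ∃ φ : V ≃ W, ∀ u v : V, G.Adj u v ↔ H.Adj (φ u) (φ v)

/-- `G` has no directed cycle (in particular no loop and no directed 2-cycle). -/
def IsDAG {V : Type} (G : Digraph V) : Prop :=
  ∀ v : V, ¬ Relation.TransGen G.Adj v v

/-- `G` is an oriented graph: it has no loop and no directed 2-cycle
(a loop at `u` is excluded by taking `v = u`). -/
def IsOrientedGraph {V : Type} (G : Digraph V) : Prop :=
  ∀ u v : V, G.Adj u v → ¬ G.Adj v u

/-- `G` is an oriented clique: an oriented graph in which any two distinct non-adjacent vertices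
are the two ends of a directed path of length 2 (in one direction or the other). -/
def IsOrientedClique {V : Type} (G : Digraph V) : Prop :=
  IsOrientedGraph G ∧
    ∀ u v : V, u ≠ v → ¬ G.Adj u v → ¬ G.Adj v u →
      ∃ w : V, (G.Adj u w ∧ G.Adj w v) ∨ (G.Adj v w ∧ G.Adj w u)

/-- `T` is a regular tournament: exactly one arc between any two distinct vertices, no loops, and
all in-degrees and out-degrees are equal. -/
def IsRegularTournament {V : Type} (T : Digraph V) : Prop :=
  IsOrientedGraph T ∧ (∀ u v : V, u ≠ v → T.Adj u v ∨ T.Adj v u) ∧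
    ∃ d : ℕ, ∀ v : V, {w | T.Adj v w}.ncard = d ∧ {w | T.Adj w v}.ncard = d

/-- The vertices of the construction: the left copy `u^L` and the right copy `u^R` of each vertex
`u` of `G`, and the vertices of the tournament `T`. -/
inductive StarVertex (V W : Type) : Type
  | left (u : V)
  | right (u : V)
  | tour (t : W)

/-- The adjacency relation of the construction `G⋆` from `G` and the tournament `T`. -/
def StarAdj {V W : Type} (G : Digraph V) (T : Digraph W) : StarVertex V W → StarVertex V W → Prop
  | .left u, .left v => G.Adj u v
  | .right u, .right v => G.Adj u v
  | .tour s, .tour t => T.Adj s t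
  | .left u, .right v => u = v
  | .right u, .left v => u ≠ v
  | .left _, .tour _ => True
  | .tour _, .right _ => True
  | .tour _, .left _ => False
  | .right _, .tour _ => False

/-- The directed graph `G⋆` built from two copies of `G` and the tournament `T`. -/
def starDigraph {V W : Type} (G : Digraph V) (T : Digraph W) : Digraph (StarVertex V W) where
  Adj := StarAdj G T

/-! ### Finite graphs as inputs -/

/-- Finite directed graphs, with vertex set `{0, …, n - 1}`. -/
abbrev FinDigraph : Type := Σ n : ℕ, Digraph (Fin n)

/-- Finite simple graphs, with vertex set `{0, …, n - 1}`. -/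
abbrev FinGraph : Type := Σ n : ℕ, SimpleGraph (Fin n)

/-- The numbering of the vertices of `G⋆`: first the left copy, then the right copy, then the
tournament. -/
def starEquiv (n m : ℕ) : StarVertex (Fin n) (Fin m) ≃ Fin (n + (n + m)) :=
  Equiv.trans
    { toFun := fun x => match x with
        | .left u => Sum.inl u
        | .right u => Sum.inr (Sum.inl u)
        | .tour t => Sum.inr (Sum.inr t)
      invFun := fun x => match x with
        | Sum.inl u => .left u
        | Sum.inr (Sum.inl u) => .right u
        | Sum.inr (Sum.inr t) => .tour t
      left_inv := by rintro (u | u | t) <;> rfl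
      right_inv := by rintro (u | u | t) <;> rfl }
    ((Equiv.sumCongr (Equiv.refl (Fin n)) finSumFinEquiv).trans finSumFinEquiv)

/-- `G⋆` as a directed graph on `{0, …, 4n}`, for `G` on `n` vertices, where `T n` is the
tournament on `2n + 1` vertices used in the construction. -/
def star (T : (n : ℕ) → Digraph (Fin (2 * n + 1))) (G : FinDigraph) : FinDigraph :=
  ⟨G.1 + (G.1 + (2 * G.1 + 1)),
    { Adj := fun x y => (starDigraph G.2 (T G.1)).Adj
        ((starEquiv G.1 (2 * G.1 + 1)).symm x) ((starEquiv G.1 (2 * G.1 + 1)).symm y) }⟩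

/-! ### Encoding of graphs by bit strings -/

open Classical in
/-- The entries of the 0/1 matrix of the relation `r`, row by row. -/
noncomputable def matrixBits {n : ℕ} (r : Fin n → Fin n → Prop) : List Bool :=
  (List.finRange n).flatMap fun i => (List.finRange n).map fun j => decide (r i j)

/-- A graph on `n` vertices is written as `n` in unary followed by its adjacency matrix. -/
noncomputable def encodeRel {n : ℕ} (r : Fin n → Fin n → Prop) : List Bool :=
  List.replicate n true ++ false :: matrixBits r

noncomputable def encodeDigraph (G : FinDigraph) : List Bool := encodeRel G.2.Adj

noncomputable def encodeGraph (G : FinGraph) : List Bool := encodeRel G.2.Adj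

theorem matrixBits_length {n : ℕ} (r : Fin n → Fin n → Prop) :
    (matrixBits r).length = n * n := by
  simp [matrixBits, List.length_flatMap]

theorem matrixBits_injective {n : ℕ} {r s : Fin n → Fin n → Prop}
    (h : matrixBits r = matrixBits s) : r = s := by
  classical
  have key : ∀ l : List (Fin n),
      (l.flatMap fun i => (List.finRange n).map fun j => decide (r i j)) =
        (l.flatMap fun i => (List.finRange n).map fun j => decide (s i j)) →
      ∀ i ∈ l, ∀ j, r i j ↔ s i j := by
    intro l
    induction l with
    | nil => simp
    | cons a l ih =>
      intro hl i hi j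
      rw [List.flatMap_cons, List.flatMap_cons] at hl
      obtain ⟨h1, h2⟩ := List.append_inj hl (by simp)
      rcases List.mem_cons.1 hi with rfl | hi
      · have := List.map_inj_left.1 h1 j (List.mem_finRange j)
        simpa using this
      · exact ih h2 i hi j
  funext i j
  refine propext (key (List.finRange n) ?_ i (List.mem_finRange i) j)
  unfold matrixBits at h
  convert h

/-- The encoding is self-delimiting, so that two encoded graphs can be written one after the
other. -/
theorem encodeRel_append_inj {n m : ℕ} {r : Fin n → Fin n → Prop} {s : Fin m → Fin m → Prop}
    {l l' : List Bool} (h : encodeRel r ++ l = encodeRel s ++ l') :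
    (⟨n, r⟩ : Σ k : ℕ, (Fin k → Fin k → Prop)) = ⟨m, s⟩ ∧ l = l' := by
  have hu : ∀ (a b : ℕ) (x y : List Bool),
      List.replicate a true ++ false :: x = List.replicate b true ++ false :: y →
        a = b ∧ x = y := by
    intro a
    induction a with
    | zero =>
      intro b x y hxy
      cases b with
      | zero => simpa using hxy
      | succ b => simp [List.replicate_succ] at hxy
    | succ a ih =>
      intro b x y hxy
      cases b with
      | zero => simp [List.replicate_succ] at hxy
      | succ b =>
        simp only [List.replicate_succ, List.cons_append, List.cons.injEq, true_and] at hxy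
        obtain ⟨h1, h2⟩ := ih b x y hxy
        exact ⟨by rw [h1], h2⟩
  simp only [encodeRel, List.append_assoc, List.cons_append] at h
  obtain ⟨rfl, h2⟩ := hu _ _ _ _ h
  obtain ⟨h3, h4⟩ := List.append_inj h2 (by simp [matrixBits_length])
  rw [matrixBits_injective h3]
  exact ⟨rfl, h4⟩

theorem encodeDigraph_append_inj {G H : FinDigraph} {l l' : List Bool}
    (h : encodeDigraph G ++ l = encodeDigraph H ++ l') : G = H ∧ l = l' := by
  obtain ⟨n, G⟩ := G
  obtain ⟨m, H⟩ := H
  obtain ⟨h1, h2⟩ := encodeRel_append_inj h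
  obtain ⟨rfl, h3⟩ := Sigma.mk.inj_iff.1 h1
  refine ⟨?_, h2⟩
  exact congrArg (Sigma.mk n) (Digraph.ext (eq_of_heq h3))

theorem encodeGraph_append_inj {G H : FinGraph} {l l' : List Bool}
    (h : encodeGraph G ++ l = encodeGraph H ++ l') : G = H ∧ l = l' := by
  obtain ⟨n, G⟩ := G
  obtain ⟨m, H⟩ := H
  obtain ⟨h1, h2⟩ := encodeRel_append_inj h
  obtain ⟨rfl, h3⟩ := Sigma.mk.inj_iff.1 h1
  refine ⟨?_, h2⟩
  exact congrArg (Sigma.mk n) (SimpleGraph.ext (eq_of_heq h3))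

/-! ### Decision problems and polynomial-time reductions -/

/-- A decision problem: its instances, their encoding by bit strings, and the question. -/
structure DecisionProblem where
  Instance : Type
  encode : Instance → List Bool
  encode_injective : Function.Injective encode
  Yes : Instance → Prop

/-- `f` is a polynomial-time many-one reduction of `P` to `Q`: some multi-stack Turing machine
maps the encoding of every instance `x` of `P` to the encoding of the instance `f x` of `Q` in
time polynomial in the length of the encoding of `x`, and the answers to `x` and `f x` agree. -/
def IsPolyTimeReduction (P Q : DecisionProblem) (f : P.Instance → Q.Instance) : Prop :=
  Nonempty (Turing.TM2ComputableInPolyTime P.encode Q.encode f) ∧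
    ∀ x : P.Instance, P.Yes x ↔ Q.Yes (f x)

/-- `P` is polynomial-time many-one reducible to `Q`. -/
def PolyTimeReducible (P Q : DecisionProblem) : Prop :=
  ∃ f : P.Instance → Q.Instance, IsPolyTimeReduction P Q f

/-- The graph isomorphism problem. -/
noncomputable def graphIso : DecisionProblem where
  Instance := FinGraph × FinGraph
  encode p := encodeGraph p.1 ++ encodeGraph p.2
  encode_injective := by
    rintro ⟨G, H⟩ ⟨G', H'⟩ h
    obtain ⟨h1, h2⟩ := encodeGraph_append_inj h
    have h3 : encodeGraph H ++ [] = encodeGraph H' ++ [] := by simpa using h2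
    exact Prod.ext h1 (encodeGraph_append_inj h3).1
  Yes p := Nonempty (p.1.2 ≃g p.2.2)

/-- The isomorphism problem for the finite directed graphs with the property `C`: an instance is
a pair of such graphs, the question is whether they are isomorphic. -/
noncomputable def digraphIsoProblem (C : FinDigraph → Prop) : DecisionProblem where
  Instance := {G : FinDigraph // C G} × {G : FinDigraph // C G}
  encode p := encodeDigraph p.1.1 ++ encodeDigraph p.2.1
  encode_injective := by
    rintro ⟨G, H⟩ ⟨G', H'⟩ h
    obtain ⟨h1, h2⟩ := encodeDigraph_append_inj h
    have h3 : encodeDigraph H.1 ++ [] = encodeDigraph H'.1 ++ [] := by simpa using h2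
    exact Prod.ext (Subtype.ext h1) (Subtype.ext (encodeDigraph_append_inj h3).1)
  Yes p := DigraphIso p.1.1.2 p.2.1.2

/-- DAGISO: given two directed acyclic graphs, are they isomorphic? -/
noncomputable def dagIso : DecisionProblem := digraphIsoProblem fun G => IsDAG G.2

/-- OCLIQUEISO: given two oriented cliques, are they isomorphic? -/
noncomputable def ocliqueIso : DecisionProblem := digraphIsoProblem fun G => IsOrientedClique G.2

/-- `Q` is GI-hard: the graph isomorphism problem reduces to `Q` in polynomial time. -/
def IsGIHard (Q : DecisionProblem) : Prop := PolyTimeReducible graphIso Q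

/-- `Q` is GI-complete: `Q` is polynomial-time equivalent to the graph isomorphism problem. -/
def IsGIComplete (Q : DecisionProblem) : Prop := PolyTimeReducible Q graphIso ∧ IsGIHard Q

end OCliqueGI

/-! The construction `G⋆` is decoded by out-degrees. A left vertex sends arcs to all `2n + 1`
vertices of the tournament. A right vertex sends arcs only into the two copies, so to at most `2n`
vertices. A tournament vertex has at most `n` out-neighbours in the tournament, by regularity, and
`n` right ones. Hence the left copy consists exactly of the vertices of out-degree above `2n`, and
an isomorphism `G⋆ → H⋆` restricts to an isomorphism `G → H` (`digraphIso_of_starDigraph`).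
Non-adjacent pairs lie within one copy and are joined by `u^L u^R v^L` or `u^R v^L v^R`.

For hardness, a graph is first turned into a three-layer acyclic digraph with arcs `source u →
middle u → sink u`, and `source u → sink v` for each adjacent pair. Its only directed paths of
length 2 are the triples of a single vertex, so the graph can be recovered; then `⋆` is applied. For
membership, an oriented clique is turned into a simple graph in which arcs run from tails to heads;
triangles and leaves mark the kinds of vertices, which an isomorphism must therefore respect.

Polynomial time is proved for actual multi-stack machines. All the maps have one shape: an `n × n`
matrix becomes a square of `k × k` blocks of size `n`, plus one row and column, where the entry `(i,
j)` of a block depends only on `A i j`, `A j i` and the order of `i` and `j`. `BlockRule` records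
such a map, and a single program parametrised by the rule computes it on a pair of graphs
(`BlockRule.computableInPolyTime`). The composite of the layer construction with `⋆` is again a
block rule (`BlockRule.comp`), so machines need not be composed. The tournaments fit the shape when
they are rotational: `2n + 1` vertices are two blocks and the extra vertex.

Programs are written in a small structured language. `Runs` quantifies over every machine that
contains the code of the program, so that correctness and time bounds compose. -/

namespace OCliqueGI

open Turing

/-! ### Structured programs for multi-stack Turing machines -/

/-- Structured programs over stacks of bits named by `K`, with a local variable in `σ`.
`loop k f g p` pops from the stack `k`, updates the local variable by `f`, and, as long as `g`
holds then, executes `p` and starts again. -/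
inductive Prog (K σ : Type) : Type
  | push (k : K) (f : σ → Bool)
  | pop (k : K) (f : σ → Option Bool → σ)
  | load (f : σ → σ)
  | seq (p q : Prog K σ)
  | ite (g : σ → Bool) (p q : Prog K σ)
  | loop (k : K) (f : σ → Option Bool → σ) (g : σ → Bool) (p : Prog K σ)

namespace Prog

variable {K σ : Type}

/-- The labels of the machine that executes a program. -/
def Lab : Prog K σ → Type
  | push _ _ => Unit
  | pop _ _ => Unit
  | load _ => Unit
  | seq p q => p.Lab ⊕ q.Lab
  | ite _ p q => Option (p.Lab ⊕ q.Lab)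
  | loop _ _ _ p => Option p.Lab

noncomputable instance fintypeLab : (p : Prog K σ) → Fintype p.Lab
  | push _ _ => inferInstanceAs (Fintype Unit)
  | pop _ _ => inferInstanceAs (Fintype Unit)
  | load _ => inferInstanceAs (Fintype Unit)
  | seq p q =>
    have := fintypeLab p
    have := fintypeLab q
    inferInstanceAs (Fintype (p.Lab ⊕ q.Lab))
  | ite _ p q =>
    have := fintypeLab p
    have := fintypeLab q
    inferInstanceAs (Fintype (Option (p.Lab ⊕ q.Lab)))
  | loop _ _ _ p =>
    have := fintypeLab p
    inferInstanceAs (Fintype (Option p.Lab))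

/-- The label at which the execution of a program starts. -/
def entry : (p : Prog K σ) → p.Lab
  | push _ _ => ()
  | pop _ _ => ()
  | load _ => ()
  | seq p _ => Sum.inl p.entry
  | ite _ _ _ => none
  | loop _ _ _ _ => none

/-- The machine code of a program whose labels are embedded by `emb` into the labels of a machine
and which jumps to `exit` at its end. -/
def code {Λ : Type} : (p : Prog K σ) → (p.Lab → Λ) → Λ → p.Lab → TM2.Stmt (fun _ : K => Bool) Λ σ
  | push k f, _, exit, _ => .push k f (.goto fun _ => exit)
  | pop k f, _, exit, _ => .pop k f (.goto fun _ => exit)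
  | load f, _, exit, _ => .load f (.goto fun _ => exit)
  | seq p q, emb, _, Sum.inl a => p.code (fun x => emb (Sum.inl x)) (emb (Sum.inr q.entry)) a
  | seq _ q, emb, exit, Sum.inr b => q.code (fun x => emb (Sum.inr x)) exit b
  | ite g p q, emb, _, none =>
    .branch g (.goto fun _ => emb (some (Sum.inl p.entry)))
      (.goto fun _ => emb (some (Sum.inr q.entry)))
  | ite _ p _, emb, exit, some (Sum.inl a) => p.code (fun x => emb (some (Sum.inl x))) exit a
  | ite _ _ q, emb, exit, some (Sum.inr b) => q.code (fun x => emb (some (Sum.inr x))) exit b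
  | loop k f g p, emb, exit, none =>
    .pop k f (.branch g (.goto fun _ => emb (some p.entry)) (.goto fun _ => exit))
  | loop _ _ _ p, emb, _, some a => p.code (fun x => emb (some x)) (emb none) a

variable [DecidableEq K]

/-- The machine `m` gets from the configuration `c` to `c'` in at most `t` steps. -/
def ReachIn {Λ : Type} (m : Λ → TM2.Stmt (fun _ : K => Bool) Λ σ)
    (c c' : TM2.Cfg (fun _ : K => Bool) Λ σ) (t : ℕ) : Prop :=
  ∃ t' ≤ t, (flip bind (TM2.step m))^[t'] (some c) = some c'

theorem ReachIn.trans {Λ : Type} {m : Λ → TM2.Stmt (fun _ : K => Bool) Λ σ}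
    {a b c : TM2.Cfg (fun _ : K => Bool) Λ σ} {t t' : ℕ} (h : ReachIn m a b t)
    (h' : ReachIn m b c t') : ReachIn m a c (t + t') := by
  obtain ⟨u, hu, h⟩ := h
  obtain ⟨u', hu', h'⟩ := h'
  exact ⟨u' + u, by omega, by rw [Function.iterate_add_apply, h, h']⟩

theorem ReachIn.step {Λ : Type} {m : Λ → TM2.Stmt (fun _ : K => Bool) Λ σ}
    {l : Λ} {v : σ} {S : K → List Bool} {c : TM2.Cfg (fun _ : K => Bool) Λ σ}
    (h : TM2.stepAux (m l) v S = c) : ReachIn m ⟨some l, v, S⟩ c 1 :=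
  ⟨1, le_rfl, by rw [← h]; rfl⟩

/-- Started with the local variable and the stacks given by `s`, the program `p` ends with those
given by `s'` after at most `t` steps. -/
def Runs (p : Prog K σ) (s s' : σ × (K → List Bool)) (t : ℕ) : Prop :=
  ∀ (Λ : Type) (m : Λ → TM2.Stmt (fun _ : K => Bool) Λ σ) (emb : p.Lab → Λ) (exit : Λ),
    (∀ a, m (emb a) = p.code emb exit a) →
      ReachIn m ⟨some (emb p.entry), s.1, s.2⟩ ⟨some exit, s'.1, s'.2⟩ t

variable {p q : Prog K σ} {s s' s'' : σ × (K → List Bool)} {t t' : ℕ}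

theorem Runs.mono (h : Runs p s s' t) (ht : t ≤ t') : Runs p s s' t' := by
  intro Λ m emb exit hm
  obtain ⟨u, hu, h⟩ := h Λ m emb exit hm
  exact ⟨u, hu.trans ht, h⟩

theorem Runs.of_eq (h : Runs p s s' t) {a b : σ × (K → List Bool)} (h1 : s.1 = a.1)
    (h2 : ∀ k, s.2 k = a.2 k) (h3 : s'.1 = b.1) (h4 : ∀ k, s'.2 k = b.2 k) : Runs p a b t := by
  have e1 : s = a := Prod.ext h1 (funext h2)
  have e2 : s' = b := Prod.ext h3 (funext h4)
  rwa [← e1, ← e2]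

theorem runs_push (k : K) (f : σ → Bool) (v : σ) (S : K → List Bool) :
    Runs (push k f) (v, S) (v, Function.update S k (f v :: S k)) 1 := by
  intro Λ m emb exit hm
  apply ReachIn.step
  rw [hm]
  rfl

theorem runs_pop (k : K) (f : σ → Option Bool → σ) (v : σ) (S : K → List Bool) :
    Runs (pop k f) (v, S) (f v (S k).head?, Function.update S k (S k).tail) 1 := by
  intro Λ m emb exit hm
  apply ReachIn.step
  rw [hm]
  rfl

theorem runs_load (f : σ → σ) (v : σ) (S : K → List Bool) :
    Runs (load f) (v, S) (f v, S) 1 := by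
  intro Λ m emb exit hm
  apply ReachIn.step
  rw [hm]
  rfl

/-- The exit label of `p` is the entry of `q`, and both hypotheses apply to the same ambient machine
because `Runs` allows any machine that contains the code. -/
theorem Runs.seq (h : Runs p s s' t) (h' : Runs q s' s'' t') :
    Runs (seq p q) s s'' (t + t') := by
  intro Λ m emb exit hm
  exact (h Λ m _ _ fun a => hm (Sum.inl a)).trans (h' Λ m _ _ fun b => hm (Sum.inr b))

theorem Runs.ite_true {g : σ → Bool} (hg : g s.1 = true) (h : Runs p s s' t) :
    Runs (ite g p q) s s' (t + 1) := by
  intro Λ m emb exit hm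
  rw [add_comm]
  refine ReachIn.trans (ReachIn.step ?_) (h Λ m _ _ fun a => hm (some (Sum.inl a)))
  rw [hm]
  simp [code, entry, hg]

theorem Runs.ite_false {g : σ → Bool} (hg : g s.1 = false) (h : Runs q s s' t) :
    Runs (ite g p q) s s' (t + 1) := by
  intro Λ m emb exit hm
  rw [add_comm]
  refine ReachIn.trans (ReachIn.step ?_) (h Λ m _ _ fun a => hm (some (Sum.inr a)))
  rw [hm]
  simp [code, entry, hg]

theorem runs_loop_exit {k : K} {f : σ → Option Bool → σ} {g : σ → Bool}
    {v : σ} {S : K → List Bool} (hg : g (f v (S k).head?) = false) :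
    Runs (loop k f g p) (v, S) (f v (S k).head?, Function.update S k (S k).tail) 1 := by
  intro Λ m emb exit hm
  apply ReachIn.step
  rw [hm]
  simp [code, entry, hg]

/-- The body exits to the head of its own loop, so what follows the first iteration is a run of the
same loop. -/
theorem Runs.loop_step {k : K} {f : σ → Option Bool → σ} {g : σ → Bool}
    {v : σ} {S : K → List Bool} (hg : g (f v (S k).head?) = true)
    (h : Runs p (f v (S k).head?, Function.update S k (S k).tail) s' t)
    (h' : Runs (loop k f g p) s' s'' t') :
    Runs (loop k f g p) (v, S) s'' (t + 1 + t') := by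
  intro Λ m emb exit hm
  rw [add_comm t]
  refine ReachIn.trans (ReachIn.trans (ReachIn.step ?_) (h Λ m _ _ fun a => hm (some a)))
    (h' Λ m _ _ hm)
  rw [hm]
  simp [code, entry, hg]

/-- The machine that executes a program, with the input and the output on the stack `k`. -/
noncomputable def machine [Fintype K] [Fintype σ] (p : Prog K σ) (k : K) (v : σ) : FinTM2 where
  K := K
  k₀ := k
  k₁ := k
  Γ _ := Bool
  Λ := Option p.Lab
  main := some p.entry
  σ := σ
  initialState := v
  Γk₀Fin := inferInstanceAs (Fintype Bool)
  m
    | none => .halt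
    | some a => p.code some none a

/-- The run must end with the initial value `v` and all other stacks empty, since `haltList`
prescribes exactly that configuration. -/
theorem computableInPolyTime_of_runs [Fintype K] [Fintype σ] (p : Prog K σ) (k : K) (v : σ)
    {α β : Type} (ea : α → List Bool) (eb : β → List Bool) (f : α → β) (P : Polynomial ℕ)
    (h : ∀ a, Runs p (v, Function.update (fun _ => []) k (ea a))
      (v, Function.update (fun _ => []) k (eb (f a))) (P.eval (ea a).length)) :
    Nonempty (TM2ComputableInPolyTime ea eb f) := by
  have key : ∀ l : List Bool, Function.update (fun _ : K => ([] : List Bool)) k l =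
      fun k' => @dite (List Bool) (k' = k) (inferInstance) (fun _ => l) fun _ => [] := by
    intro l
    funext k'
    by_cases hk : k' = k <;> simp [Function.update, hk]
  refine ⟨{
    tm := p.machine k v
    inputAlphabet := Equiv.refl Bool
    outputAlphabet := Equiv.refl Bool
    -- One step more than the run of `p`, for the `halt` at the exit label.
    time := P + 1
    outputsFun := fun a => Classical.choice ?_ }⟩
  obtain ⟨u, hu, h1⟩ := h a (Option p.Lab) (p.machine k v).m some none fun _ => rfl
  have h2 : (flip bind (TM2.step (p.machine k v).m))^[u + 1]
      (some (initList (p.machine k v) (ea a))) = some (haltList (p.machine k v) (eb (f a))) := by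
    rw [Function.iterate_succ_apply']
    have h3 : initList (p.machine k v) (ea a) =
        ⟨some (some p.entry), v, Function.update (fun _ => []) k (ea a)⟩ :=
      congrArg (fun S => (⟨some (some p.entry), v, S⟩ :
        TM2.Cfg (fun _ : K => Bool) (Option p.Lab) σ)) (key (ea a)).symm
    have h4 : haltList (p.machine k v) (eb (f a)) =
        ⟨none, v, Function.update (fun _ => []) k (eb (f a))⟩ :=
      congrArg (fun S => (⟨none, v, S⟩ :
        TM2.Cfg (fun _ : K => Bool) (Option p.Lab) σ)) (key (eb (f a))).symm
    rw [h3, h4]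
    erw [h1]
    rfl
  refine ⟨⟨⟨u + 1, ?_⟩, ?_⟩⟩
  -- The required input and output are images of the encodings under the identity of the alphabet;
  -- generalising the lists lets `List.map_id` remove it.
  · have h5 : ∀ l l' : List Bool, l = ea a → l' = eb (f a) →
        (flip bind (TM2.step (p.machine k v).m))^[u + 1]
          (some (initList (p.machine k v) l)) = some (haltList (p.machine k v) l') := by
      rintro _ _ rfl rfl
      exact h2
    exact h5 _ _ (List.map_id _) (List.map_id _)
  · simpa using hu

end Prog

/-! ### Programs on unary counters and a matrix -/

/-- The stacks of the machine: the input, the part of the input that has been read, the output in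
reverse order, and unary counters. -/
inductive Reg : Type
  | inp | aux | acc | num | row | rowDone | col | colDone | tmp | tmp'
  deriving DecidableEq

instance : Fintype Reg where
  elems := {.inp, .aux, .acc, .num, .row, .rowDone, .col, .colDone, .tmp, .tmp'}
  complete r := by cases r <;> decide

/-- The local variable of the machine: the bit popped last, two matrix entries, and the result of
a comparison. -/
structure Flags : Type where
  bit : Option Bool
  fwd : Bool
  bwd : Bool
  lt : Bool
  gt : Bool
  deriving DecidableEq, Fintype

def Flags.init : Flags := ⟨none, false, false, false, false⟩

def Flags.setBit (v : Flags) (o : Option Bool) : Flags := { v with bit := o }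

@[simp] theorem Flags.setBit_setBit (v : Flags) (o o' : Option Bool) :
    (v.setBit o).setBit o' = v.setBit o' := rfl

@[simp] theorem Flags.setBit_bit (v : Flags) (o : Option Bool) : (v.setBit o).bit = o := rfl

theorem Flags.setBit_self (v : Flags) : v.setBit v.bit = v := rfl

/-- The unary notation of a number. -/
abbrev ones (n : ℕ) : List Bool := List.replicate n true

namespace Prog

/-- Pop from `k` until it is empty, with an execution of `p` after each successful pop. -/
def each (k : Reg) (p : Prog Reg Flags) : Prog Reg Flags :=
  loop k Flags.setBit (fun v => v.bit.isSome) p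

/-- `F i` is the state after `i` iterations. The last popped bit is left free by the `∃ o`, because
the next pop overwrites it. -/
theorem runs_each {p : Prog Reg Flags} (k : Reg) (F : ℕ → Flags × (Reg → List Bool)) (n t : ℕ)
    (hk : ∀ i ≤ n, (F i).2 k = ones (n - i))
    (body : ∀ i < n, ∃ o, Runs p ((F i).1.setBit (some true),
      Function.update (F i).2 k (ones (n - (i + 1)))) ((F (i + 1)).1.setBit o, (F (i + 1)).2) t) :
    Runs (each k p) (F 0) ((F n).1.setBit none, (F n).2) ((t + 1) * n + 1) := by
  -- The induction is on the number `j` of iterations that remain.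
  have key : ∀ j ≤ n, ∀ o, Runs (each k p) ((F (n - j)).1.setBit o, (F (n - j)).2)
      ((F n).1.setBit none, (F n).2) ((t + 1) * j + 1) := by
    intro j
    induction j with
    | zero =>
      intro _ o
      have h0 : (F n).2 k = [] := by simpa using hk n le_rfl
      have h := runs_loop_exit (p := p) (k := k) (f := Flags.setBit)
        (g := fun v => v.bit.isSome) (v := (F n).1.setBit o) (S := (F n).2) (by simp [h0])
      have h1 : Function.update (F n).2 k ((F n).2 k).tail = (F n).2 := by
        rw [h0, List.tail_nil, ← h0, Function.update_eq_self]
      rw [h1, h0] at h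
      simpa [each] using h
    | succ j ih =>
      intro hj o
      obtain ⟨o', hb⟩ := body (n - (j + 1)) (by omega)
      have h0 : (F (n - (j + 1))).2 k = true :: ones j := by
        rw [hk _ (by omega), show n - (n - (j + 1)) = j + 1 by omega]
        rfl
      rw [show n - (j + 1) + 1 = n - j by omega, show n - (n - j) = j by omega] at hb
      refine (Runs.loop_step (s' := ((F (n - j)).1.setBit o', (F (n - j)).2)) (t := t) ?_ ?_
        (ih (by omega) o')).mono ?_
      · simp [h0]
      · simpa [h0] using hb
      · ring_nf; omega
  have := key n le_rfl (F 0).1.bit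
  simpa [Flags.setBit_self] using this

/-- Move the elements of `a` to `b`, one after the other. -/
def move (a b : Reg) : Prog Reg Flags :=
  each a (push b fun v => v.bit.getD true)

/-- The contents are arbitrary here, not just unary: the same program restores the input after a
lookup and puts the final output into the right order. -/
theorem runs_move {a b : Reg} (hab : a ≠ b) (v : Flags) (S : Reg → List Bool) :
    Runs (move a b) (v, S) (v.setBit none,
      Function.update (Function.update S a []) b ((S a).reverse ++ S b))
      (2 * (S a).length + 1) := by
  obtain ⟨l, hl⟩ : ∃ l, S a = l := ⟨_, rfl⟩
  rw [hl]
  induction l generalizing v S with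
  | nil =>
    have h := runs_loop_exit (p := push b fun v => v.bit.getD true) (k := a) (f := Flags.setBit)
      (g := fun v => v.bit.isSome) (v := v) (S := S) (by simp [hl])
    refine h.of_eq rfl (fun r => rfl) (by simp [hl]) (fun r => ?_)
    by_cases hr : r = b
    · subst hr; simp [hab.symm, hl]
    · simp [hr, hl]
  | cons x l ih =>
    refine (Runs.loop_step (t := 1) (s' := (v.setBit (some x),
      Function.update (Function.update S a l) b (x :: S b))) ?_ ?_
      (s'' := (v.setBit none, Function.update (Function.update S a []) b
        ((x :: l).reverse ++ S b))) (t' := 2 * l.length + 1) ?_).mono ?_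
    · simp [hl]
    · have := runs_push b (fun v => v.bit.getD true) (v.setBit (some x)) (Function.update S a l)
      simpa [hl, hab.symm] using this
    · have := ih (v.setBit (some x)) (Function.update (Function.update S a l) b (x :: S b))
        (by simp [hab])
      have h1 : Function.update (Function.update (Function.update (Function.update S a l) b
          (x :: S b)) a []) b (l.reverse ++ x :: S b) =
          Function.update (Function.update S a []) b ((x :: l).reverse ++ S b) := by
        rw [Function.update_comm hab.symm]
        simp
      simp only [Function.update_self] at this
      rw [h1] at this
      exact this
    · simp; omega

/-- Execute `p` as often as the counter `k` says, without changing `k`. -/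
def times (k k' : Reg) (p : Prog Reg Flags) : Prog Reg Flags :=
  seq (each k (seq (push k' fun _ => true) p)) (move k' k)

/-- The counter passes from `k` to `k'` during the loop and is moved back afterwards. The body
therefore has to work whatever these two stacks hold, which is the role of `a` and `b`. Each
iteration costs `t`, a push, a pop, and 2 steps of the move. -/
theorem runs_times {p : Prog Reg Flags} {k k' : Reg} (hkt : k ≠ k')
    (F : ℕ → Flags × (Reg → List Bool)) (n t : ℕ)
    (hk : ∀ i ≤ n, (F i).2 k = ones n) (ht : ∀ i ≤ n, (F i).2 k' = [])
    (body : ∀ i < n, ∀ a b, ∃ o, Runs p ((F i).1.setBit (some true),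
      Function.update (Function.update (F i).2 k (ones a)) k' (ones b))
      ((F (i + 1)).1.setBit o,
        Function.update (Function.update (F (i + 1)).2 k (ones a)) k' (ones b)) t) :
    Runs (times k k' p) (F 0) ((F n).1.setBit none, (F n).2) ((t + 4) * n + 2) := by
  -- The actual states: after `i` iterations, `n - i` marks are left on `k` and `i` are on `k'`.
  let G : ℕ → Flags × (Reg → List Bool) := fun i => ((F i).1,
    Function.update (Function.update (F i).2 k (ones (n - i))) k' (ones i))
  have hG0 : G 0 = F 0 := by
    have h1 : Function.update (F 0).2 k (ones (n - 0)) = (F 0).2 := by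
      rw [Nat.sub_zero, ← hk 0 (Nat.zero_le _)]; simp
    have h2 : Function.update (F 0).2 k' (ones 0) = (F 0).2 := by
      rw [show ones 0 = (F 0).2 k' from (ht 0 (Nat.zero_le _)).symm]; simp
    simp only [G]
    rw [h1, h2]
  have h1 : Runs (each k (seq (push k' fun _ => true) p)) (G 0) ((G n).1.setBit none, (G n).2)
      ((1 + t + 1) * n + 1) := by
    refine runs_each k G n (1 + t) ?_ ?_
    · intro i _
      simp [G, hkt]
    · intro i hi
      obtain ⟨o, hb⟩ := body i hi (n - (i + 1)) (i + 1)
      refine ⟨o, (Runs.seq (runs_push _ _ _ _) ?_)⟩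
      refine hb.of_eq rfl (fun r => ?_) rfl (fun r => rfl)
      by_cases hr : r = k
      · subst hr; simp [G, hkt]
      · by_cases hr' : r = k'
        · subst hr'; simp [G, hr, List.replicate_succ]
        · simp [G, hr, hr']
  have h2 := runs_move hkt.symm ((G n).1.setBit none) (G n).2
  have h3 : Function.update (Function.update (G n).2 k' []) k
      (((G n).2 k').reverse ++ (G n).2 k) = (F n).2 := by
    funext r
    by_cases h : r = k
    · subst h
      simp [G, hkt, hk n le_rfl]
    · by_cases h' : r = k'
      · subst h'
        simp [h, ht n le_rfl]
      · simp [G, h, h']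
  rw [h3] at h2
  rw [hG0] at h1
  refine (h1.seq h2).mono ?_
  simp [G]
  ring_nf
  omega

/-- Copy the counter `num` to `k`. -/
def copyNum (k : Reg) : Prog Reg Flags := times .num .tmp' (push k fun _ => true)

theorem runs_copyNum {k : Reg} (h1 : k ≠ .num) (h2 : k ≠ .tmp') {n : ℕ} (v : Flags)
    {S : Reg → List Bool} (hn : S .num = ones n) (ht : S .tmp' = []) (hk : S k = []) :
    Runs (copyNum k) (v, S) (v.setBit none, Function.update S k (ones n)) (5 * n + 2) := by
  have := runs_times (p := push k fun _ => true) (k := .num) (k' := .tmp') (by decide)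
    (fun i => (v, Function.update S k (ones i))) n 1 (by intros; simp [h1.symm, hn])
    (by intros; simp [h2.symm, ht]) (by
      intro i _ a b
      refine ⟨some true, ?_⟩
      refine (runs_push _ _ _ _).of_eq rfl (fun r => rfl) rfl (fun r => ?_)
      by_cases hr : r = k
      · subst hr; simp [h1, h2, List.replicate_succ]
      · simp only [Function.update_apply, hr, if_false])
  refine this.of_eq rfl (fun r => ?_) rfl (fun r => rfl)
  by_cases hr : r = k
  · subst hr; simp [hk]
  · simp [hr]

/-- Empty the stack `k`. -/
def clear (k : Reg) : Prog Reg Flags := each k (load fun v => v)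

theorem runs_clear {k : Reg} {n : ℕ} (v : Flags) {S : Reg → List Bool} (hk : S k = ones n) :
    Runs (clear k) (v, S) (v.setBit none, Function.update S k []) (2 * n + 1) := by
  have := runs_each (p := load fun v => v) k (fun i => (v, Function.update S k (ones (n - i))))
    n 1 (by intros; simp) (by
      intro i _
      refine ⟨some true, ?_⟩
      exact (runs_load _ _ _).of_eq rfl (fun r => rfl) rfl (fun r => by simp))
  refine this.of_eq rfl (fun r => ?_) rfl (fun r => by simp)
  by_cases hr : r = k
  · subst hr; simp [hk]
  · simp [hr]

/-! ### Reading the matrix -/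

/-- The stacks after the first `p` elements of the input `M` have been read. -/
def readTo (S : Reg → List Bool) (M : List Bool) (p : ℕ) : Reg → List Bool :=
  Function.update (Function.update S .inp (M.drop p)) .aux (M.take p).reverse

theorem readTo_zero {S : Reg → List Bool} {M : List Bool} (hM : S .inp = M) (ha : S .aux = []) :
    readTo S M 0 = S := by
  funext r
  cases r <;> simp [readTo, hM, ha]

/-- Read one bit of the input. -/
def shift : Prog Reg Flags := seq (pop .inp Flags.setBit) (push .aux fun v => v.bit.getD true)

/-- By `hp` the pop succeeds, so the default value of the pushed bit is never used. -/
theorem runs_shift (v : Flags) (S : Reg → List Bool) {M : List Bool} {p : ℕ} (hp : p < M.length) :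
    Runs shift (v, readTo S M p) (v.setBit (some M[p]), readTo S M (p + 1)) 2 := by
  refine Runs.seq (t := 1) (t' := 1) (runs_pop _ _ _ _) ?_
  have h : readTo S M p .inp = M[p] :: M.drop (p + 1) := by
    simp [readTo]
  rw [h]
  have h' : (M.take (p + 1)).reverse = M[p] :: (M.take p).reverse := by
    rw [List.take_add_one]
    simp [hp]
  refine (runs_push _ _ _ _).of_eq rfl (fun r => rfl) rfl (fun r => ?_)
  cases r <;> simp [readTo, h', hp]

/-- Read a row of the matrix. -/
def skipRow : Prog Reg Flags := times .num .tmp' shift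

theorem runs_skipRow (v : Flags) {S : Reg → List Bool} {M : List Bool} {p n : ℕ}
    (hn : S .num = ones n) (ht : S .tmp' = []) (hp : p + n ≤ M.length) :
    Runs skipRow (v, readTo S M p) (v.setBit none, readTo S M (p + n)) (6 * n + 2) := by
  refine runs_times (by decide) (fun i => (v, readTo S M (p + i))) n 2 (by simp [readTo, hn])
    (by simp [readTo, ht]) ?_
  intro i hi a b
  refine ⟨some (M[p + i]), ?_⟩
  have := runs_shift (v.setBit (some true))
    (Function.update (Function.update S .num (ones a)) .tmp' (ones b))
    (M := M) (p := p + i) (by omega)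
  refine this.of_eq rfl (fun r => ?_) rfl (fun r => ?_)
  · cases r <;> simp [readTo]
  · cases r <;> simp [readTo, add_assoc]

/-- The two loop counters. -/
def idx (c : Bool) : Reg := cond c .rowDone .colDone

def skipRows (c : Bool) : Prog Reg Flags := times (idx c) .tmp skipRow

/-- Two nested counter loops, with `tmp` as scratch stack of the outer and `tmp'` of the inner one;
the position `i * n` is reached without arithmetic on the counters. -/
theorem runs_skipRows (c : Bool) (v : Flags) {S : Reg → List Bool} {M : List Bool} {i n : ℕ}
    (hn : S .num = ones n) (ht : S .tmp = []) (ht' : S .tmp' = []) (hi : S (idx c) = ones i)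
    (hp : i * n ≤ M.length) :
    Runs (skipRows c) (v, readTo S M 0) (v.setBit none, readTo S M (i * n))
      ((6 * n + 2 + 4) * i + 2) := by
  have hc : ∀ r : Reg, r = .tmp ∨ r = .inp ∨ r = .aux ∨ r = .num ∨ r = .tmp' → idx c ≠ r := by
    cases c <;> simp [idx]
  have := runs_times (p := skipRow) (k := idx c) (k' := .tmp) (hc _ (by simp))
    (fun i => (v, readTo S M (i * n))) i (6 * n + 2)
    (by simp [readTo, hi, hc]) (by simp [readTo, ht]) (by
      intro j hj a b
      refine ⟨none, ?_⟩
      have h1 : (j + 1) * n ≤ i * n := Nat.mul_le_mul_right n hj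
      rw [add_mul, one_mul] at h1
      have := runs_skipRow (v.setBit (some true))
        (S := Function.update (Function.update S (idx c) (ones a)) .tmp (ones b))
        (M := M) (p := j * n) (n := n) (by simp [hc _ _ |>.symm, hn])
        (by simp [hc _ _ |>.symm, ht']) (by omega)
      refine this.of_eq rfl (fun r => ?_) rfl (fun r => ?_)
      · cases c <;> cases r <;> simp [readTo, idx]
      · cases c <;> cases r <;> simp [readTo, idx, add_mul])
  refine this.of_eq rfl (fun r => by simp) rfl (fun r => rfl)

def skipCols (c : Bool) : Prog Reg Flags := times (idx c) .tmp shift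

theorem runs_skipCols (c : Bool) (v : Flags) {S : Reg → List Bool} {M : List Bool} {p i : ℕ}
    (ht : S .tmp = []) (hi : S (idx c) = ones i) (hp : p + i ≤ M.length) :
    Runs (skipCols c) (v, readTo S M p) (v.setBit none, readTo S M (p + i)) (6 * i + 2) := by
  have hc : ∀ r : Reg, r = .tmp ∨ r = .inp ∨ r = .aux → idx c ≠ r := by
    cases c <;> simp [idx]
  refine runs_times (hc _ (by simp)) (fun i => (v, readTo S M (p + i))) i 2
    (by simp [readTo, hi, hc]) (by simp [readTo, ht]) ?_
  intro j hj a b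
  refine ⟨some (M[p + j]), ?_⟩
  have := runs_shift (v.setBit (some true))
    (Function.update (Function.update S (idx c) (ones a)) .tmp (ones b))
    (M := M) (p := p + j) (by omega)
  refine this.of_eq rfl (fun r => ?_) rfl (fun r => ?_)
  · cases c <;> cases r <;> simp [readTo, idx]
  · cases c <;> cases r <;> simp [readTo, idx, add_assoc]

/-- Look up the matrix entry given by the two counters and store it in the local variable. -/
def lookup (c : Bool) (store : Flags → Flags) : Prog Reg Flags :=
  seq (skipRows c) (seq (skipCols !c) (seq shift (seq (load store) (move .aux .inp))))

/-- The bits up to and including position `i * n + j` go to `aux`, `store` saves the last one before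
it is overwritten, and moving `aux` back restores the input. The flag `c` selects the counter used
as row index, so that the transposed entry is found by the same program. -/
theorem runs_lookup (c : Bool) (store : Flags → Flags) (v : Flags) {S : Reg → List Bool}
    {M : List Bool} {i j n : ℕ} (hM : S .inp = M) (ha : S .aux = [])
    (hn : S .num = ones n) (ht : S .tmp = []) (ht' : S .tmp' = []) (hi : S (idx c) = ones i)
    (hj : S (idx !c) = ones j) (hin : i < n) (hjn : j < n) (hp : n * n ≤ M.length) :
    Runs (lookup c store) (v, S)
      ((store (v.setBit (some (M.getD (i * n + j) true)))).setBit none, S) (30 * (n + 1) ^ 2) := by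
  have hlt : i * n + j < M.length := by
    have : (i + 1) * n ≤ n * n := Nat.mul_le_mul_right n hin
    rw [add_mul] at this
    omega
  have h1 := runs_skipRows c v (M := M) hn ht ht' hi (by omega)
  rw [readTo_zero hM ha] at h1
  have h2 := runs_skipCols (!c) (v.setBit none) (M := M) (p := i * n) ht hj (by omega)
  have h3 := runs_shift ((v.setBit none).setBit none) S (M := M) (p := i * n + j) hlt
  have h4 := runs_load store (v.setBit (some M[i * n + j])) (readTo S M (i * n + j + 1))
  have h5 := runs_move (a := .aux) (b := .inp) (by decide) (store (v.setBit (some M[i * n + j])))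
    (readTo S M (i * n + j + 1))
  have h6 : Function.update (Function.update (readTo S M (i * n + j + 1)) .aux []) .inp
      ((readTo S M (i * n + j + 1) .aux).reverse ++ readTo S M (i * n + j + 1) .inp) = S := by
    funext r
    cases r <;> simp [readTo, ha, hM]
  rw [h6] at h5
  have h7 : M.getD (i * n + j) true = M[i * n + j] := by simp [hlt]
  rw [h7]
  refine (h1.seq (h2.seq (h3.seq (h4.seq h5)))).mono ?_
  have h8 : (readTo S M (i * n + j + 1) .aux).length = i * n + j + 1 := by
    simp [readTo]; omega
  rw [h8]
  nlinarith

/-- Compare the two loop counters. -/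
def compare : Prog Reg Flags :=
  seq (load fun v => { v with lt := false, gt := false })
  (seq (each .rowDone (seq (push .tmp fun _ => true) (seq (pop .colDone Flags.setBit)
    (ite (fun v => v.bit.isSome) (push .tmp' fun _ => true)
      (load fun v => { v with gt := true })))))
  (seq (pop .colDone Flags.setBit)
  (seq (ite (fun v => v.bit.isSome) (seq (push .colDone fun _ => true)
    (load fun v => { v with lt := true })) (load fun v => v))
  (seq (move .tmp .rowDone) (move .tmp' .colDone)))))

theorem runs_compare (v : Flags) {S : Reg → List Bool} {i j : ℕ} (ht : S .tmp = [])
    (ht' : S .tmp' = []) (hi : S .rowDone = ones i) (hj : S .colDone = ones j) :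
    Runs compare (v, S)
      ({ v with bit := none, lt := decide (i < j), gt := decide (j < i) }, S)
      (20 * (i + 1)) := by
  -- After `k` rounds, `k` marks have gone from `rowDone` to `tmp` and `min k j` from `colDone` to
  -- `tmp'`; `gt` is set once `colDone` has run out.
  let F : ℕ → Flags × (Reg → List Bool) := fun k =>
    ({ v with lt := false, gt := decide (j < k) },
      Function.update (Function.update (Function.update (Function.update S .rowDone (ones (i - k)))
        .colDone (ones (j - k))) .tmp (ones k)) .tmp' (ones (min k j)))
  have hF0 : F 0 = ({ v with lt := false, gt := false }, S) := by
    refine Prod.ext (by simp [F]) ?_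
    funext r
    cases r <;> simp [F, *]
  have h0 := runs_load (fun v => { v with lt := false, gt := false }) v S
  rw [← hF0] at h0
  have h1 := runs_each (p := seq (push .tmp fun _ => true) (seq (pop .colDone Flags.setBit)
    (ite (fun v => v.bit.isSome) (push .tmp' fun _ => true)
      (load fun v => { v with gt := true })))) .rowDone F i 4 (by intros; simp [F]) (by
      intro k hk
      by_cases hkj : k < j
      · refine ⟨some true, Runs.seq (t := 1) (t' := 3) (runs_push _ _ _ _)
          (Runs.seq (t := 1) (t' := 2) (runs_pop _ _ _ _) (Runs.ite_true ?_ ?_))⟩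
        · simp [F, Flags.setBit, List.head?_replicate]
          omega
        · refine (runs_push _ _ _ _).of_eq rfl (fun r => rfl) ?_ (fun r => ?_)
          · have : ¬ j < k + 1 := by omega
            have h' : ¬ j < k := by omega
            have h'' : j - k ≠ 0 := by omega
            simp [F, Flags.setBit, this, h', h'', List.head?_replicate]
          · cases r <;> simp [F, List.replicate_succ, Nat.sub_sub]
            rw [min_eq_left (by omega), min_eq_left (by omega)]; rfl
      · refine ⟨none, Runs.seq (t := 1) (t' := 3) (runs_push _ _ _ _)
          (Runs.seq (t := 1) (t' := 2) (runs_pop _ _ _ _) (Runs.ite_false ?_ ?_))⟩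
        · simp [F, Flags.setBit, List.head?_replicate]
          omega
        · refine (runs_load _ _ _).of_eq rfl (fun r => rfl) ?_ (fun r => ?_)
          · have : j < k + 1 := by omega
            have h'' : j - k = 0 := by omega
            simp [F, Flags.setBit, this, h'']
          · cases r <;> simp [F, List.replicate_succ, Nat.sub_sub]
            rw [min_eq_right (by omega), min_eq_right (by omega)])
  -- A further pop succeeds exactly when `i < j`; the mark is then put back and `lt` is set.
  have h2 := runs_pop .colDone Flags.setBit ((F i).1.setBit none) (F i).2
  have h3 : Runs (ite (fun v => v.bit.isSome) (seq (push .colDone fun _ => true)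
    (load fun v => { v with lt := true })) (load fun v => v))
      (((F i).1.setBit none).setBit ((F i).2 .colDone).head?,
        Function.update (F i).2 .colDone ((F i).2 .colDone).tail)
      (⟨((F i).2 .colDone).head?, v.fwd, v.bwd, decide (i < j), decide (j < i)⟩, (F i).2) 3 := by
    by_cases hij : i < j
    · refine Runs.ite_true ?_ (Runs.seq (t := 1) (t' := 1) (runs_push _ _ _ _) ?_)
      · simp [F, Flags.setBit, List.head?_replicate]
        omega
      · refine (runs_load _ _ _).of_eq rfl (fun r => rfl) ?_ (fun r => ?_)
        · simp [F, Flags.setBit, hij]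
        · obtain ⟨d, hd⟩ : ∃ d, j - i = d + 1 := ⟨j - i - 1, by omega⟩
          cases r <;> simp [F, hd, List.replicate_succ]
    · refine Runs.mono (t := 2) (Runs.ite_false (t := 1) ?_ ?_) (by omega)
      · simp [F, Flags.setBit, List.head?_replicate]
        omega
      · refine (runs_load _ _ _).of_eq rfl (fun r => rfl) ?_ (fun r => ?_)
        · simp [F, Flags.setBit, hij]
        · have hd : j - i = 0 := by omega
          cases r <;> simp [F, hd]
  have h4 := runs_move (a := .tmp) (b := .rowDone) (by decide)
    ⟨((F i).2 .colDone).head?, v.fwd, v.bwd, decide (i < j), decide (j < i)⟩ (F i).2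
  have h5 := runs_move (a := .tmp') (b := .colDone) (by decide)
    (Flags.setBit ⟨((F i).2 .colDone).head?, v.fwd, v.bwd, decide (i < j), decide (j < i)⟩ none)
    (Function.update (Function.update (F i).2 .tmp []) .rowDone
      (((F i).2 .tmp).reverse ++ (F i).2 .rowDone))
  have h6 := h0.seq (h1.seq (h2.seq (h3.seq (h4.seq h5))))
  have h7 : Runs compare _ _ _ := h6
  refine (h7.of_eq (a := (v, S)) (b := (⟨none, v.fwd, v.bwd, decide (i < j), decide (j < i)⟩, S))
    rfl (fun r => rfl) rfl (fun r => ?_)).mono ?_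
  · cases r <;> simp [F, ht, ht', hi, hj]
    omega
  · simp [F]
    omega

end Prog

/-- A rule that turns an `n × n` matrix `A` of bits into a matrix with `blocks * n + 1` rows and
columns: `blocks × blocks` blocks of size `n × n`, and one more row and column. The entry `(i, j)`
of the block `(b, c)` is `entry b c (A i j) (A j i) (i < j) (j < i)`; the last column is constant
on each block `b` with value `toExtra b`, the last row is constant on each block `c` with value
`fromExtra c`. -/
structure BlockRule : Type where
  blocks : ℕ
  entry : ℕ → ℕ → Bool → Bool → Bool → Bool → Bool
  toExtra : ℕ → Bool
  fromExtra : ℕ → Bool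

/-! ### Programs that write the entries of the new matrix. -/

namespace Prog

/-- Whatever the local variable, `p` writes the bits `L` to the output and resets the local
variable. -/
def Emits (p : Prog Reg Flags) (S : Reg → List Bool) (L : List Bool) (t : ℕ) : Prop :=
  ∀ v x, Runs p (v, Function.update S .acc x)
    (Flags.init, Function.update S .acc (L.reverse ++ x)) t

theorem Emits.seq {p q : Prog Reg Flags} {S : Reg → List Bool} {L L' : List Bool} {t t' : ℕ}
    (h : Emits p S L t) (h' : Emits q S L' t') : Emits (seq p q) S (L ++ L') (t + t') := by
  intro v x
  have := (h v x).seq (h' Flags.init (L.reverse ++ x))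
  simpa using this

/-- Write one bit to the output. -/
def emit (f : Flags → Bool) : Prog Reg Flags := seq (push .acc f) (load fun _ => Flags.init)

theorem emits_emit (b : Bool) (S : Reg → List Bool) : Emits (emit fun _ => b) S [b] 2 := by
  intro v x
  have h1 := runs_push .acc (fun _ => b) v (Function.update S .acc x)
  have h2 := runs_load (fun _ => Flags.init) v (Function.update S .acc (b :: x))
  simp only [Function.update_idem, Function.update_self] at h1
  exact h1.seq h2

/-- Execute the programs `p b` for the elements `b` of a list. -/
def seqList (p : ℕ → Prog Reg Flags) : List ℕ → Prog Reg Flags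
  | [] => load fun _ => Flags.init
  | b :: l => seq (p b) (seqList p l)

/-- The number of blocks is a constant of the rule, so the iteration over blocks is unrolled in the
program and needs no counter. -/
theorem emits_seqList {p : ℕ → Prog Reg Flags} {S : Reg → List Bool} {L : ℕ → List Bool} {t : ℕ}
    (h : ∀ b, Emits (p b) S (L b) t) (l : List ℕ) :
    Emits (seqList p l) S (l.flatMap L) (t * l.length + 1) := by
  induction l with
  | nil => exact fun v x => runs_load _ v _
  | cons b l ih =>
    intro v x
    exact ((h b).seq ih v x).mono (by simp only [List.length_cons]; ring_nf; omega)

/-- The counter of the remaining iterations of a loop. -/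
def cnt (c : Bool) : Reg := cond c .row .col

/-- Execute `p` for each `i < n`, where `n` is the content of the counter `num`; during the
execution, the loop counter `idx c` contains `i`. -/
def forIdx (c : Bool) (p : Prog Reg Flags) : Prog Reg Flags :=
  seq (copyNum (cnt c)) (seq (each (cnt c) (seq p (push (idx c) fun _ => true)))
    (seq (clear (idx c)) (load fun _ => Flags.init)))

theorem emits_forIdx {c : Bool} {p : Prog Reg Flags} {S : Reg → List Bool} {L : ℕ → List Bool}
    {n t : ℕ} (hn : S .num = ones n) (ht : S .tmp' = []) (hc : S (cnt c) = [])
    (hi : S (idx c) = []) (h : ∀ i < n, ∀ k, Emits p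
      (Function.update (Function.update S (cnt c) (ones k)) (idx c) (ones i)) (L i) t) :
    Emits (forIdx c p) S ((List.range n).flatMap L) ((t + 20) * (n + 1)) := by
  intro v x
  have h1 := runs_copyNum (k := cnt c) (n := n) (by cases c <;> decide) (by cases c <;> decide) v
    (S := Function.update S .acc x) (by simp [hn]) (by simp [ht])
    (by cases c <;> simpa [cnt] using hc)
  -- Before the first iteration the local variable is what `copyNum` left; afterwards the body has
  -- reset it.
  let F : ℕ → Flags × (Reg → List Bool) := fun i =>
    (if i = 0 then v.setBit none else Flags.init,
      Function.update (Function.update (Function.update S .acc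
        (((List.range i).flatMap L).reverse ++ x)) (cnt c) (ones (n - i))) (idx c) (ones i))
  have h2 := runs_each (p := seq p (push (idx c) fun _ => true)) (cnt c) F n (t + 1)
    (by intro i _; cases c <;> simp [F, cnt, idx]) (by
      intro i hin
      refine ⟨none, Runs.seq (s' := (Flags.init, Function.update (Function.update
        (Function.update S .acc (((List.range (i + 1)).flatMap L).reverse ++ x)) (cnt c)
          (ones (n - (i + 1)))) (idx c) (ones i))) ?_ ?_⟩
      · refine (h i hin (n - (i + 1)) ((F i).1.setBit (some true))
          (((List.range i).flatMap L).reverse ++ x)).of_eq rfl (fun r => ?_) rfl (fun r => ?_)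
        · cases c <;> cases r <;> simp [F, cnt, idx]
        · cases c <;> cases r <;> simp [cnt, idx, List.range_succ]
      · refine (runs_push _ _ _ _).of_eq rfl (fun r => rfl) rfl (fun r => ?_)
        cases c <;> cases r <;> simp [F, cnt, idx, List.replicate_succ])
  have h3 := runs_clear (k := idx c) (n := n) ((F n).1.setBit none) (S := (F n).2)
    (by simp [F])
  have h4 := runs_load (fun _ => Flags.init) (((F n).1.setBit none).setBit none)
    (Function.update (F n).2 (idx c) [])
  have h5 : Runs (forIdx c p) _ _ _ := (h1.of_eq (b := F 0) rfl (fun r => rfl) rfl (fun r => by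
    cases c <;> cases r <;> simp_all [F, cnt, idx])).seq (h2.seq (h3.seq h4))
  refine (h5.of_eq (a := (v, Function.update S .acc x)) (b := (Flags.init, Function.update S .acc
    (((List.range n).flatMap L).reverse ++ x))) rfl (fun r => rfl) rfl (fun r => ?_)).mono ?_
  · cases c <;> cases r <;> simp_all [F, cnt, idx]
  · ring_nf
    omega

/-- Write the entry of a block at the position given by the two loop counters. -/
def emitEntry (φ : Bool → Bool → Bool → Bool → Bool) : Prog Reg Flags :=
  seq (lookup true fun v => { v with fwd := v.bit.getD true })
  (seq (lookup false fun v => { v with bwd := v.bit.getD true })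
  (seq compare (emit fun v => φ v.fwd v.bwd v.lt v.gt)))

theorem emits_emitEntry (φ : Bool → Bool → Bool → Bool → Bool) {S : Reg → List Bool}
    {M : List Bool} {i j n : ℕ} (hM : S .inp = M) (ha : S .aux = [])
    (hn : S .num = ones n) (ht : S .tmp = []) (ht' : S .tmp' = []) (hi : S .rowDone = ones i)
    (hj : S .colDone = ones j) (hin : i < n) (hjn : j < n) (hp : n * n ≤ M.length) :
    Emits (emitEntry φ) S [φ (M.getD (i * n + j) true) (M.getD (j * n + i) true)
      (decide (i < j)) (decide (j < i))] (90 * (n + 1) ^ 2) := by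
  intro v x
  have h1 := runs_lookup true (fun v => { v with fwd := v.bit.getD true }) v
    (S := Function.update S .acc x) (M := M) (i := i) (j := j) (n := n) (by simp [hM])
    (by simp [ha]) (by simp [hn]) (by simp [ht]) (by simp [ht']) (by simp [idx, hi])
    (by simp [idx, hj]) hin hjn hp
  have h2 := runs_lookup false (fun v => { v with bwd := v.bit.getD true })
    ⟨none, M.getD (i * n + j) true, v.bwd, v.lt, v.gt⟩
    (S := Function.update S .acc x) (M := M) (i := j) (j := i) (n := n) (by simp [hM])
    (by simp [ha]) (by simp [hn]) (by simp [ht]) (by simp [ht']) (by simp [idx, hj])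
    (by simp [idx, hi]) hjn hin hp
  have h3 := runs_compare ⟨none, M.getD (i * n + j) true, M.getD (j * n + i) true, v.lt, v.gt⟩
    (S := Function.update S .acc x) (i := i) (j := j) (by simp [ht]) (by simp [ht'])
    (by simp [hi]) (by simp [hj])
  have h4 := runs_push .acc (fun v : Flags => φ v.fwd v.bwd v.lt v.gt)
    ⟨none, M.getD (i * n + j) true, M.getD (j * n + i) true, decide (i < j), decide (j < i)⟩
    (Function.update S .acc x)
  have h5 := runs_load (fun _ => Flags.init)
    ⟨none, M.getD (i * n + j) true, M.getD (j * n + i) true, decide (i < j), decide (j < i)⟩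
    (Function.update S .acc (φ (M.getD (i * n + j) true) (M.getD (j * n + i) true)
      (decide (i < j)) (decide (j < i)) :: x))
  simp only [Function.update_idem, Function.update_self] at h4
  refine Runs.mono (h1.seq (h2.seq (h3.seq (h4.seq h5)))) ?_
  nlinarith

/-- Read `n` in unary. -/
def parse : Prog Reg Flags :=
  loop .inp Flags.setBit (fun v => v.bit == some true) (push .num fun _ => true)

/-- The `false` after the unary prefix ends the loop and is consumed by it. The content `k` already
on `num` is general for the sake of the induction. -/
theorem runs_parse {n k : ℕ} {M : List Bool} (v : Flags) {S : Reg → List Bool}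
    (hi : S .inp = ones n ++ false :: M) (hk : S .num = ones k) :
    Runs parse (v, S) (v.setBit (some false),
      Function.update (Function.update S .inp M) .num (ones (k + n))) (2 * n + 1) := by
  induction n generalizing v S k with
  | zero =>
    have := runs_loop_exit (p := push .num fun _ => true) (k := .inp) (f := Flags.setBit)
      (g := fun v => v.bit == some true) (v := v) (S := S) (by simp [hi])
    refine Runs.of_eq this rfl (fun r => rfl) (by simp [hi]) (fun r => ?_)
    cases r <;> simp [hi, hk]
  | succ n ih =>
    have hi' : S .inp = true :: (ones n ++ false :: M) := hi
    refine (Runs.loop_step (t := 1) (t' := 2 * n + 1) (s' := (v.setBit (some true),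
      Function.update (Function.update S .inp (ones n ++ false :: M)) .num (ones (k + 1))))
      ?_ ?_ ?_).mono (t := 1 + 1 + (2 * n + 1)) (by omega)
    · simp [hi']
    · refine (runs_push _ _ _ _).of_eq rfl (fun r => rfl) (by simp [hi']) (fun r => ?_)
      cases r <;> simp [hi', hk, List.replicate_succ]
    · refine (ih (v.setBit (some true)) (k := k + 1) (S := Function.update
        (Function.update S .inp (ones n ++ false :: M)) .num (ones (k + 1))) (by simp)
        (by simp)).of_eq rfl (fun r => rfl) rfl (fun r => ?_)
      cases r <;> simp [add_assoc, add_comm 1 n]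

/-- Discard the matrix at the beginning of the input. -/
def dropMatrix : Prog Reg Flags :=
  seq (copyNum .row) (each .row (times .num .tmp' (pop .inp Flags.setBit)))

theorem runs_dropMatrix {n : ℕ} {M : List Bool} (v : Flags) {S : Reg → List Bool}
    (hM : S .inp = M) (hn : S .num = ones n) (ht : S .tmp' = []) (hr : S .row = []) :
    Runs dropMatrix (v, S) (v.setBit none, Function.update S .inp (M.drop (n * n)))
      (20 * (n + 1) ^ 2) := by
  have hrow : ∀ (v : Flags) (S : Reg → List Bool) (M : List Bool), S .inp = M →
      S .num = ones n → S .tmp' = [] →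
      Runs (times .num .tmp' (pop .inp Flags.setBit)) (v, S)
        (v.setBit none, Function.update S .inp (M.drop n)) ((1 + 4) * n + 2) := by
    intro v S M hM hn ht
    have := runs_times (p := pop .inp Flags.setBit) (k := .num) (k' := .tmp') (by decide)
      (fun i => (v, Function.update S .inp (M.drop i))) n 1 (by simp [hn]) (by simp [ht]) (by
        intro i hi a b
        refine ⟨(M.drop i).head?, (runs_pop _ _ _ _).of_eq rfl (fun r => rfl) (by simp)
          (fun r => ?_)⟩
        cases r <;> simp)
    refine this.of_eq rfl (fun r => ?_) rfl (fun r => rfl)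
    cases r <;> simp [hM]
  have h1 := runs_copyNum (k := .row) (n := n) (by decide) (by decide) v hn ht hr
  have h2 := runs_each (p := times .num .tmp' (pop .inp Flags.setBit)) .row
    (fun i => (v.setBit none, Function.update (Function.update S .row (ones (n - i))) .inp
      (M.drop (i * n)))) n ((1 + 4) * n + 2) (by simp) (by
        intro i hi
        refine ⟨none, (hrow ((v.setBit none).setBit (some true)) (Function.update
          (Function.update S .row (ones (n - (i + 1)))) .inp (M.drop (i * n))) (M.drop (i * n))
          (by simp) (by simp [hn]) (by simp [ht])).of_eq rfl (fun r => ?_) rfl (fun r => ?_)⟩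
        · cases r <;> simp
        · cases r <;> simp [add_mul])
  have h3 : Runs dropMatrix _ _ _ := h1.seq (h2.of_eq rfl (fun r => by
    cases r <;> simp [hM]) rfl (fun r => rfl))
  refine (h3.of_eq (a := (v, S)) (b := (v.setBit none, Function.update S .inp (M.drop (n * n))))
    rfl (fun r => rfl) rfl (fun r => ?_)).mono ?_
  · cases r <;> simp [hr]
  · nlinarith

end Prog

/-! ### The program of a block rule and its running time. -/

namespace BlockRule

open Prog

variable (B : BlockRule)

/-- The unary notation of the number of rows of the new matrix, followed by its entries. -/
def bits (n : ℕ) (M : List Bool) : List Bool :=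
  ((List.range B.blocks).flatMap fun _ => (List.range n).flatMap fun _ => [true]) ++ ([true] ++
  ([false] ++ (((List.range B.blocks).flatMap fun b => (List.range n).flatMap fun i =>
      ((List.range B.blocks).flatMap fun c => (List.range n).flatMap fun j =>
        [B.entry b c (M.getD (i * n + j) true) (M.getD (j * n + i) true)
          (decide (i < j)) (decide (j < i))]) ++ [B.toExtra b]) ++
  (((List.range B.blocks).flatMap fun c => (List.range n).flatMap fun _ => [B.fromExtra c]) ++
  [false]))))

/-- The program that writes the new matrix. -/
def writer : Prog Reg Flags :=
  seq (seqList (fun _ => forIdx false (emit fun _ => true)) (List.range B.blocks))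
  (seq (emit fun _ => true)
  (seq (emit fun _ => false)
  (seq (seqList (fun b => forIdx true (seq
      (seqList (fun c => forIdx false (emitEntry (B.entry b c))) (List.range B.blocks))
      (emit fun _ => B.toExtra b))) (List.range B.blocks))
  (seq (seqList (fun c => forIdx false (emit fun _ => B.fromExtra c)) (List.range B.blocks))
  (emit fun _ => false)))))

/-- A bound for the running time of `writer`. -/
def writerTime (n : ℕ) : ℕ :=
  2 * ((2 + 20) * (n + 1) * B.blocks + 1) + 6 +
    ((((90 * (n + 1) ^ 2 + 20) * (n + 1) * B.blocks + 1 + 2) + 20) * (n + 1) * B.blocks + 1)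

/-- `M` is all of the remaining input, possibly with a second graph behind the matrix, so only a
lower bound on its length is assumed. -/
theorem emits_writer {S : Reg → List Bool} {M : List Bool} {n : ℕ} (hM : S .inp = M)
    (hn : S .num = ones n) (h0 : ∀ r, r ≠ .inp → r ≠ .num → r ≠ .acc → S r = [])
    (hp : n * n ≤ M.length) :
    Emits B.writer S (B.bits n M) (B.writerTime n) := by
  -- Used both for the unary header and for the last row.
  have hconst : ∀ f : ℕ → Bool, Emits (seqList (fun c => forIdx false (emit fun _ => f c))
      (List.range B.blocks)) S ((List.range B.blocks).flatMap fun c =>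
        (List.range n).flatMap fun _ => [f c]) ((2 + 20) * (n + 1) * B.blocks + 1) := by
    intro f
    have := emits_seqList (S := S) (p := fun c => forIdx false (emit fun _ => f c))
      (fun c => emits_forIdx (c := false) (L := fun _ => [f c]) hn (h0 _ (by decide) (by decide)
        (by decide)) (h0 _ (by decide) (by decide) (by decide))
        (h0 _ (by decide) (by decide) (by decide)) (fun i _ k => emits_emit (f c) _))
      (List.range B.blocks)
    rwa [List.length_range] at this
  have hmain : Emits (seqList (fun b => forIdx true (seq
      (seqList (fun c => forIdx false (emitEntry (B.entry b c))) (List.range B.blocks))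
      (emit fun _ => B.toExtra b))) (List.range B.blocks)) S
      ((List.range B.blocks).flatMap fun b => (List.range n).flatMap fun i =>
      ((List.range B.blocks).flatMap fun c => (List.range n).flatMap fun j =>
        [B.entry b c (M.getD (i * n + j) true) (M.getD (j * n + i) true)
          (decide (i < j)) (decide (j < i))]) ++ [B.toExtra b])
      ((((90 * (n + 1) ^ 2 + 20) * (n + 1) * B.blocks + 1 + 2) + 20) * (n + 1) * B.blocks + 1) := by
    have := emits_seqList (S := S) (p := fun b => forIdx true (seq
      (seqList (fun c => forIdx false (emitEntry (B.entry b c))) (List.range B.blocks))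
      (emit fun _ => B.toExtra b)))
      (L := fun b => (List.range n).flatMap fun i =>
        ((List.range B.blocks).flatMap fun c => (List.range n).flatMap fun j =>
          [B.entry b c (M.getD (i * n + j) true) (M.getD (j * n + i) true)
            (decide (i < j)) (decide (j < i))]) ++ [B.toExtra b])
      (t := (((90 * (n + 1) ^ 2 + 20) * (n + 1) * B.blocks + 1 + 2) + 20) * (n + 1))
      (fun b => emits_forIdx (c := true) hn
        (h0 _ (by decide) (by decide) (by decide)) (h0 _ (by decide) (by decide) (by decide))
        (h0 _ (by decide) (by decide) (by decide)) (by
          intro i hi k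
          refine Emits.seq ?_ (emits_emit _ _)
          have h1 := emits_seqList (p := fun c => forIdx false (emitEntry (B.entry b c)))
            (S := Function.update (Function.update S (cnt true) (ones k)) (idx true) (ones i))
            (L := fun c => (List.range n).flatMap fun j =>
              [B.entry b c (M.getD (i * n + j) true) (M.getD (j * n + i) true)
                (decide (i < j)) (decide (j < i))])
            (t := (90 * (n + 1) ^ 2 + 20) * (n + 1)) (by
              intro c
              refine emits_forIdx (c := false) (by simp [cnt, idx, hn])
                (by simp [cnt, idx, h0]) (by simp [cnt, idx, h0]) (by simp [cnt, idx, h0]) ?_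
              intro j hj k'
              exact emits_emitEntry _ (by simp [cnt, idx, hM]) (by simp [cnt, idx, h0])
                (by simp [cnt, idx, hn]) (by simp [cnt, idx, h0]) (by simp [cnt, idx, h0])
                (by simp [cnt, idx]) (by simp [cnt, idx]) hi hj hp) (List.range B.blocks)
          rwa [List.length_range] at h1)) (List.range B.blocks)
    rwa [List.length_range] at this
  have h := (hconst fun _ => true).seq ((emits_emit true S).seq ((emits_emit false S).seq
    (hmain.seq ((hconst B.fromExtra).seq (emits_emit false S)))))
  intro v x
  refine Runs.mono (h v x) ?_
  unfold writerTime
  omega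

/-- The program that transforms one matrix. -/
def program : Prog Reg Flags :=
  seq parse (seq B.writer (seq dropMatrix (clear .num)))

/-- The stacks with the given input and output, the other ones being empty. -/
def ioStacks (l x : List Bool) : Reg → List Bool :=
  Function.update (Function.update (fun _ => []) .inp l) .acc x

theorem runs_program {n : ℕ} {M rest : List Bool} (hM : M.length = n * n) (v : Flags)
    (x : List Bool) :
    Runs B.program (v, ioStacks (ones n ++ false :: (M ++ rest)) x)
      (Flags.init, ioStacks rest ((B.bits n (M ++ rest)).reverse ++ x))
      (2 * n + 1 + (B.writerTime n + (20 * (n + 1) ^ 2 + (2 * n + 1)))) := by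
  have h1 := runs_parse (n := n) (k := 0) (M := M ++ rest) v
    (S := ioStacks (ones n ++ false :: (M ++ rest)) x) (by simp [ioStacks]) (by simp [ioStacks])
  have h2 := B.emits_writer (S := Function.update (ioStacks (M ++ rest) x) .num (ones n))
    (M := M ++ rest) (n := n) (by simp [ioStacks]) (by simp)
    (by intro r h1 h2 h3; simp [ioStacks, h1, h2, h3]) (by simp [hM])
    (v.setBit (some false)) x
  have h3 := runs_dropMatrix (n := n) (M := M ++ rest) Flags.init
    (S := Function.update (ioStacks (M ++ rest) ((B.bits n (M ++ rest)).reverse ++ x)) .num (ones n))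
    (by simp [ioStacks]) (by simp) (by simp [ioStacks]) (by simp [ioStacks])
  have h4 := runs_clear (k := .num) (n := n) (Flags.init.setBit none)
    (S := Function.update (ioStacks rest ((B.bits n (M ++ rest)).reverse ++ x)) .num (ones n))
    (by simp)
  refine Runs.seq h1 (Runs.seq (h2.of_eq rfl (fun r => ?_) rfl (fun r => rfl))
    (Runs.seq (h3.of_eq rfl (fun r => ?_) rfl (fun r => rfl))
    (h4.of_eq rfl (fun r => ?_) rfl (fun r => ?_))))
  all_goals cases r <;> simp [ioStacks, ← hM]

/-- The program that transforms two matrices. -/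
def pairProgram : Prog Reg Flags :=
  seq B.program (seq B.program (move .acc .inp))

theorem length_bits (n : ℕ) (M : List Bool) :
    (B.bits n M).length = B.blocks * n + 2 + (B.blocks * n + 1) * (B.blocks * n + 1) := by
  simp [bits, List.length_flatMap]
  ring

/-- Both outputs accumulate on `acc` in reverse order, the second on top of the first; the final
move to the input stack reverses them together. -/
theorem runs_pairProgram {n m : ℕ} {M N : List Bool} (hM : M.length = n * n)
    (hN : N.length = m * m) :
    Runs B.pairProgram
      (Flags.init, Function.update (fun _ => []) .inp
        (ones n ++ false :: (M ++ (ones m ++ false :: N))))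
      (Flags.init, Function.update (fun _ => []) .inp
        (B.bits n (M ++ (ones m ++ false :: N)) ++ B.bits m N))
      ((2 * n + 1 + (B.writerTime n + (20 * (n + 1) ^ 2 + (2 * n + 1)))) +
        ((2 * m + 1 + (B.writerTime m + (20 * (m + 1) ^ 2 + (2 * m + 1)))) +
        (2 * ((B.blocks * n + 2 + (B.blocks * n + 1) * (B.blocks * n + 1)) +
          (B.blocks * m + 2 + (B.blocks * m + 1) * (B.blocks * m + 1))) + 1))) := by
  have h1 := B.runs_program hM (rest := ones m ++ false :: N) Flags.init []
  have h2 := B.runs_program hN (rest := []) Flags.init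
    ((B.bits n (M ++ (ones m ++ false :: N))).reverse ++ [])
  have h3 := runs_move (a := .acc) (b := .inp) (by decide) Flags.init
    (ioStacks [] ((B.bits m (N ++ [])).reverse ++
      ((B.bits n (M ++ (ones m ++ false :: N))).reverse ++ [])))
  have h4 : (ioStacks [] ((B.bits m (N ++ [])).reverse ++
      ((B.bits n (M ++ (ones m ++ false :: N))).reverse ++ [])) .acc).length =
      ((B.blocks * n + 2 + (B.blocks * n + 1) * (B.blocks * n + 1)) +
          (B.blocks * m + 2 + (B.blocks * m + 1) * (B.blocks * m + 1))) := by
    simp [ioStacks, length_bits, add_comm]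
  rw [h4] at h3
  refine Runs.seq (h1.of_eq rfl (fun r => ?_) rfl (fun r => rfl)) (Runs.seq (h2.of_eq rfl
    (fun r => ?_) rfl (fun r => rfl)) (h3.of_eq rfl (fun r => rfl) rfl (fun r => ?_)))
  all_goals cases r <;> simp [ioStacks]

/-- The share of one graph in the running time, including its part of the final move; the pair takes
`P n + P m + 1`. -/
theorem exists_polynomial_time : ∃ P : Polynomial ℕ, ∀ n,
    2 * n + 1 + (B.writerTime n + (20 * (n + 1) ^ 2 + (2 * n + 1))) +
      2 * (B.blocks * n + 2 + (B.blocks * n + 1) * (B.blocks * n + 1)) = P.eval n := by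
  open Polynomial in
  refine ⟨2 * X + 1 + ((2 * ((2 + 20) * (X + 1) * C B.blocks + 1) + 6 +
    ((((90 * (X + 1) ^ 2 + 20) * (X + 1) * C B.blocks + 1 + 2) + 20) * (X + 1) * C B.blocks + 1)) +
      (20 * (X + 1) ^ 2 + (2 * X + 1))) +
      2 * (C B.blocks * X + 2 + (C B.blocks * X + 1) * (C B.blocks * X + 1)), ?_⟩
  intro n
  simp [writerTime]

end BlockRule

theorem eval_le_eval_of_le (P : Polynomial ℕ) {m n : ℕ} (h : m ≤ n) : P.eval m ≤ P.eval n := by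
  induction P using Polynomial.induction_on' with
  | add p q hp hq => simpa using add_le_add hp hq
  | monomial k a => simpa using Nat.mul_le_mul_left a (Nat.pow_le_pow_left h k)

/-- A function that applies a block rule to two matrices is computable in polynomial time. -/
theorem BlockRule.computableInPolyTime (B : BlockRule) {α β : Type} (ea : α → List Bool)
    (eb : β → List Bool) (f : α → β)
    (h : ∀ a, ∃ n m M N, M.length = n * n ∧ N.length = m * m ∧
      ea a = ones n ++ false :: (M ++ (ones m ++ false :: N)) ∧
      eb (f a) = B.bits n (M ++ (ones m ++ false :: N)) ++ B.bits m N) :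
    Nonempty (TM2ComputableInPolyTime ea eb f) := by
  obtain ⟨P, hP⟩ := B.exists_polynomial_time
  refine Prog.computableInPolyTime_of_runs B.pairProgram .inp Flags.init ea eb f (P + P + 1) ?_
  intro a
  obtain ⟨n, m, M, N, hM, hN, h1, h2⟩ := h a
  have h3 := B.runs_pairProgram hM hN
  rw [← h1, ← h2] at h3
  refine h3.mono ?_
  -- The orders `n` and `m` are at most the input length because they are written in unary; `P` is
  -- monotone since its coefficients are natural numbers.
  have hn : P.eval n ≤ P.eval (ea a).length := eval_le_eval_of_le P (by simp [h1])
  have hm : P.eval m ≤ P.eval (ea a).length := eval_le_eval_of_le P (by simp [h1]; omega)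
  have hn' := hP n
  have hm' := hP m
  simp only [Polynomial.eval_add, Polynomial.eval_one]
  omega

/-! ### Matrices with natural-number indices -/

/-- The entries of the `n × n` matrix `A`, row by row. -/
def natBits (n : ℕ) (A : ℕ → ℕ → Bool) : List Bool :=
  (List.range n).flatMap fun i => (List.range n).map fun j => A i j

theorem length_natBits (n : ℕ) (A : ℕ → ℕ → Bool) : (natBits n A).length = n * n := by
  simp [natBits, List.length_flatMap]

open Classical in
theorem encodeRel_eq {n : ℕ} {r : Fin n → Fin n → Prop} {A : ℕ → ℕ → Bool}
    (h : ∀ i j : Fin n, A i j = decide (r i j)) :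
    encodeRel r = ones n ++ false :: natBits n A := by
  have h1 : natBits n A = matrixBits r := by
    simp only [natBits, matrixBits, ← List.map_coe_finRange_eq_range, List.flatMap_map,
      List.map_map]
    congr 1
    funext i
    exact List.map_congr_left fun j _ => h i j
  rw [encodeRel, h1]

open Classical in
/-- The adjacency matrix of a relation on `Fin n`. -/
noncomputable def natMatrix {n : ℕ} (r : Fin n → Fin n → Prop) (i j : ℕ) : Bool :=
  if h : i < n ∧ j < n then decide (r ⟨i, h.1⟩ ⟨j, h.2⟩) else false

open Classical in
theorem natMatrix_coe {n : ℕ} (r : Fin n → Fin n → Prop) (i j : Fin n) :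
    natMatrix r i j = decide (r i j) := by
  simp [natMatrix]

theorem natMatrix_eq_true {n : ℕ} (r : Fin n → Fin n → Prop) (i j : Fin n) :
    natMatrix r i j = true ↔ r i j := by
  simp [natMatrix]

theorem getD_natBits {n i j : ℕ} (A : ℕ → ℕ → Bool) (l : List Bool) (d : Bool) (hi : i < n)
    (hj : j < n) : (natBits n A ++ l).getD (i * n + j) d = A i j := by
  -- The induction is on the number `m` of rows at fixed width `n`. It splits off the last row,
  -- which joins the tail `l` if the entry lies above it.
  have key : ∀ m i, i < m → ∀ l : List Bool, (((List.range m).flatMap fun i =>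
      (List.range n).map fun j => A i j) ++ l).getD (i * n + j) d = A i j := by
    intro m
    induction m with
    | zero => intro i hi; omega
    | succ m ih =>
      intro i hi l
      rw [List.range_succ, List.flatMap_append, List.append_assoc]
      rcases Nat.lt_succ_iff_lt_or_eq.1 hi with h | rfl
      · exact ih i h _
      · have hlen : ((List.range i).flatMap fun i => (List.range n).map fun j => A i j).length =
            i * n := by simp [List.length_flatMap]
        rw [List.getD_append_right _ _ _ _ (by omega), hlen, Nat.add_sub_cancel_left]
        rw [List.getD_append _ _ _ _ (by simpa using hj)]
        simp [hj]
  exact key n i hi l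

/-! ### Block matrices -/

namespace BlockRule

variable (B : BlockRule)

/-- The matrix that the rule makes of the matrix `A`. -/
def matrix (n : ℕ) (A : ℕ → ℕ → Bool) (x y : ℕ) : Bool :=
  if x < B.blocks * n then
    if y < B.blocks * n then
      B.entry (x / n) (y / n) (A (x % n) (y % n)) (A (y % n) (x % n)) (decide (x % n < y % n))
        (decide (y % n < x % n))
    else B.toExtra (x / n)
  else if y < B.blocks * n then B.fromExtra (y / n) else false

theorem mul_add_div_of_lt {b i n : ℕ} (hi : i < n) : (b * n + i) / n = b := by
  rw [add_comm, Nat.add_mul_div_right _ _ (by omega), Nat.div_eq_of_lt hi, zero_add]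

theorem mul_add_mod_of_lt' {b i n : ℕ} (hi : i < n) : (b * n + i) % n = i := by
  rw [add_comm, Nat.add_mul_mod_self_right, Nat.mod_eq_of_lt hi]

theorem mul_add_lt_mul {b i n k : ℕ} (hb : b < k) (hi : i < n) : b * n + i < k * n := by
  have := Nat.mul_le_mul_right n (Nat.succ_le_of_lt hb)
  rw [Nat.succ_mul] at this
  omega

theorem range_mul_flatMap {α : Type} (b n : ℕ) (f : ℕ → List α) :
    (List.range (b * n)).flatMap f =
      (List.range b).flatMap fun c => (List.range n).flatMap fun i => f (c * n + i) := by
  induction b with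
  | zero => simp
  | succ b ih =>
    rw [add_mul, one_mul, List.range_add, List.flatMap_append, ih, List.range_succ,
      List.flatMap_append, List.flatMap_map]
    simp

theorem flatMap_congr' {α β : Type} {l : List α} {f g : α → List β} (h : ∀ a ∈ l, f a = g a) :
    l.flatMap f = l.flatMap g := by
  rw [List.flatMap_def, List.flatMap_def, List.map_congr_left h]

/-- The indices below `k * n + 1` are `k` runs of length `n` and one last index; this turns the
nested loops of the writer into a listing row by row. -/
theorem bits_eq {n : ℕ} {M : List Bool} {A : ℕ → ℕ → Bool}
    (h : ∀ i < n, ∀ j < n, M.getD (i * n + j) true = A i j) :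
    B.bits n M = ones (B.blocks * n + 1) ++ false :: natBits (B.blocks * n + 1) (B.matrix n A) := by
  have hones : ((List.range B.blocks).flatMap fun _ => (List.range n).flatMap fun _ => [true]) =
      ones (B.blocks * n) := by
    rw [← range_mul_flatMap _ _ fun _ => [true], ← List.map_eq_flatMap, ones, List.eq_replicate_iff]
    simp
  have hrow : ∀ x, (List.range (B.blocks * n + 1)).map (fun y => B.matrix n A x y) =
      ((List.range B.blocks).flatMap fun c => (List.range n).flatMap fun j =>
        [B.matrix n A x (c * n + j)]) ++ [B.matrix n A x (B.blocks * n)] := by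
    intro x
    rw [List.range_succ, List.map_append, ← range_mul_flatMap _ _ fun y => [B.matrix n A x y]]
    rw [← List.map_eq_flatMap]
    rfl
  unfold bits natBits
  simp only [hrow]
  rw [hones, List.range_succ, List.flatMap_append, range_mul_flatMap]
  simp only [List.flatMap_cons, List.flatMap_nil, List.append_nil]
  have h1 : ((List.range B.blocks).flatMap fun b => (List.range n).flatMap fun i =>
      ((List.range B.blocks).flatMap fun c => (List.range n).flatMap fun j =>
        [B.entry b c (M.getD (i * n + j) true) (M.getD (j * n + i) true)
          (decide (i < j)) (decide (j < i))]) ++ [B.toExtra b]) =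
      (List.range B.blocks).flatMap fun b => (List.range n).flatMap fun i =>
      ((List.range B.blocks).flatMap fun c => (List.range n).flatMap fun j =>
        [B.matrix n A (b * n + i) (c * n + j)]) ++ [B.matrix n A (b * n + i) (B.blocks * n)] := by
    refine flatMap_congr' fun b hb => flatMap_congr' fun i hi => ?_
    rw [List.mem_range] at hb hi
    congr 1
    · refine flatMap_congr' fun c hc => flatMap_congr' fun j hj => ?_
      rw [List.mem_range] at hc hj
      simp only [matrix, mul_add_lt_mul hb hi, mul_add_lt_mul hc hj, if_true, mul_add_div_of_lt hi, mul_add_div_of_lt hj, mul_add_mod_of_lt' hi, mul_add_mod_of_lt' hj,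
        h i hi j hj, h j hj i hi]
    · simp [matrix, mul_add_lt_mul hb hi, mul_add_div_of_lt hi]
  have h2 : ((List.range B.blocks).flatMap fun c => (List.range n).flatMap fun _ =>
      [B.fromExtra c]) = (List.range B.blocks).flatMap fun c => (List.range n).flatMap fun j =>
        [B.matrix n A (B.blocks * n) (c * n + j)] := by
    refine flatMap_congr' fun c hc => flatMap_congr' fun j hj => ?_
    rw [List.mem_range] at hc hj
    simp [matrix, mul_add_lt_mul hc hj, mul_add_div_of_lt hj]
  have h3 : B.matrix n A (B.blocks * n) (B.blocks * n) = false := by simp [matrix]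
  rw [h1, h2, h3, show ones (B.blocks * n + 1) = ones (B.blocks * n) ++ [true] from
    List.replicate_succ']
  simp

/-- The relation `r'` is the result of an application of the rule to the relation `r`. -/
def Transforms {n N : ℕ} (r : Fin n → Fin n → Prop) (r' : Fin N → Fin N → Prop) : Prop :=
  N = B.blocks * n + 1 ∧ ∀ x y, r' x y ↔ B.matrix n (natMatrix r) x y = true

/-- Only the first `n * n` bits are looked up, so the encoding `l` of a following graph does no
harm. -/
theorem Transforms.encodeRel_eq {n N : ℕ} {r : Fin n → Fin n → Prop} {r' : Fin N → Fin N → Prop}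
    (h : B.Transforms r r') (l : List Bool) :
    encodeRel r' = B.bits n (natBits n (natMatrix r) ++ l) := by
  obtain ⟨rfl, h⟩ := h
  rw [B.bits_eq fun i hi j hj => getD_natBits (natMatrix r) _ _ hi hj]
  exact OCliqueGI.encodeRel_eq (by simp [h])

/-- A function that applies a block rule to a pair of graphs is computable in polynomial time. -/
theorem computableInPolyTime_of_transforms {α β : Type} (ea : α → List Bool) (eb : β → List Bool)
    (f : α → β)
    (h : ∀ a, ∃ (n m N N' : ℕ) (r : Fin n → Fin n → Prop) (s : Fin m → Fin m → Prop)
      (r' : Fin N → Fin N → Prop) (s' : Fin N' → Fin N' → Prop),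
      ea a = encodeRel r ++ encodeRel s ∧ eb (f a) = encodeRel r' ++ encodeRel s' ∧
      B.Transforms r r' ∧ B.Transforms s s') :
    Nonempty (TM2ComputableInPolyTime ea eb f) := by
  refine B.computableInPolyTime ea eb f fun a => ?_
  obtain ⟨n, m, N, N', r, s, r', s', h1, h2, h3, h4⟩ := h a
  refine ⟨n, m, natBits n (natMatrix r), natBits m (natMatrix s), length_natBits _ _,
    length_natBits _ _, ?_, ?_⟩
  · rw [h1, OCliqueGI.encodeRel_eq (natMatrix_coe r), OCliqueGI.encodeRel_eq (natMatrix_coe s)]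
    simp
  · rw [h2, h3.encodeRel_eq B (ones m ++ false :: natBits m (natMatrix s)), h4.encodeRel_eq B [],
      List.append_nil]

variable {B} {n b c i j : ℕ} {A : ℕ → ℕ → Bool}

theorem matrix_block (hb : b < B.blocks) (hc : c < B.blocks) (hi : i < n) (hj : j < n) :
    B.matrix n A (b * n + i) (c * n + j) =
      B.entry b c (A i j) (A j i) (decide (i < j)) (decide (j < i)) := by
  simp only [matrix, mul_add_lt_mul hb hi, mul_add_lt_mul hc hj, if_true, mul_add_div_of_lt hi,
    mul_add_div_of_lt hj, mul_add_mod_of_lt' hi, mul_add_mod_of_lt' hj]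

theorem matrix_toExtra (hb : b < B.blocks) (hi : i < n) :
    B.matrix n A (b * n + i) (B.blocks * n) = B.toExtra b := by
  simp [matrix, mul_add_lt_mul hb hi, mul_add_div_of_lt hi]

theorem matrix_fromExtra (hc : c < B.blocks) (hj : j < n) :
    B.matrix n A (B.blocks * n) (c * n + j) = B.fromExtra c := by
  simp [matrix, mul_add_lt_mul hc hj, mul_add_div_of_lt hj]

theorem matrix_extra : B.matrix n A (B.blocks * n) (B.blocks * n) = false := by
  simp [matrix]

end BlockRule

/-! ### Isomorphisms of directed graphs -/

theorem DigraphIso.symm {V W : Type} {G : Digraph V} {H : Digraph W} (h : DigraphIso G H) :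
    DigraphIso H G := by
  obtain ⟨φ, h⟩ := h
  exact ⟨φ.symm, fun u v => by simp [h]⟩

theorem DigraphIso.trans {U V W : Type} {F : Digraph U} {G : Digraph V} {H : Digraph W}
    (h : DigraphIso F G) (h' : DigraphIso G H) : DigraphIso F H := by
  obtain ⟨φ, h⟩ := h
  obtain ⟨ψ, h'⟩ := h'
  exact ⟨φ.trans ψ, fun u v => by simp [h, h']⟩

theorem DigraphIso.isOrientedClique {V W : Type} {G : Digraph V} {H : Digraph W}
    (h : DigraphIso G H) (hG : IsOrientedClique G) : IsOrientedClique H := by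
  obtain ⟨φ, h⟩ := h.symm
  refine ⟨fun u v huv hvu => hG.1 _ _ ((h _ _).1 huv) ((h _ _).1 hvu), fun u v huv h1 h2 => ?_⟩
  obtain ⟨w, hw⟩ := hG.2 (φ u) (φ v) (by simpa using huv) (by rwa [← h]) (by rwa [← h])
  exact ⟨φ.symm w, by simpa [h] using hw⟩

theorem DigraphIso.card_eq {n m : ℕ} {G : Digraph (Fin n)} {H : Digraph (Fin m)}
    (h : DigraphIso G H) : n = m := by
  obtain ⟨φ, -⟩ := h
  simpa using Fintype.card_congr φ

theorem digraphIso_of_injective {n : ℕ} {G H : Digraph (Fin n)} (f : Fin n → Fin n)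
    (hf : Function.Injective f) (h : ∀ u v, G.Adj u v ↔ H.Adj (f u) (f v)) : DigraphIso G H :=
  ⟨Equiv.ofBijective f (Finite.injective_iff_bijective.1 hf), h⟩

theorem IsDAG.isOrientedGraph {V : Type} {G : Digraph V} (h : IsDAG G) : IsOrientedGraph G :=
  fun u _ huv hvu => h u (.tail (.single huv) hvu)

/-! ### The construction `G⋆` -/

/-- A left and a right vertex are always adjacent, and a tournament vertex is adjacent to everything
else. There remain two vertices of one copy, joined by `u^L u^R v^L` or by `u^R v^L v^R`. -/
theorem isOrientedClique_starDigraph {V W : Type} {G : Digraph V} {T : Digraph W}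
    (hG : IsOrientedGraph G) (hT : IsRegularTournament T) :
    IsOrientedClique (starDigraph G T) := by
  constructor
  · rintro (u | u | s) (v | v | t) h1 h2
    · exact hG _ _ h1 h2
    · exact h2 h1.symm
    · exact h2
    · exact h1 h2.symm
    · exact hG _ _ h1 h2
    · exact h1
    · exact h1
    · exact h2
    · exact hT.1 _ _ h1 h2
  · rintro (u | u | s) (v | v | t) h h1 h2
    · have huv : u ≠ v := fun e => h (by rw [e])
      exact ⟨.right u, Or.inl ⟨rfl, huv⟩⟩
    · exact absurd (fun e => h1 e.symm) h2
    · exact absurd trivial h1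
    · exact absurd (fun e => h2 e.symm) h1
    · have huv : u ≠ v := fun e => h (by rw [e])
      exact ⟨.left v, Or.inl ⟨huv, rfl⟩⟩
    · exact absurd trivial h2
    · exact absurd trivial h2
    · exact absurd trivial h1
    · have hst : s ≠ t := fun e => h (by rw [e])
      exact ((hT.2.1 s t hst).elim h1 h2).elim

theorem starDigraph_adj_iff (T : (n : ℕ) → Digraph (Fin (2 * n + 1))) (G : FinDigraph)
    (u v : StarVertex (Fin G.1) (Fin (2 * G.1 + 1))) : (starDigraph G.2 (T G.1)).Adj u v ↔
      (star T G).2.Adj (starEquiv G.1 (2 * G.1 + 1) u) (starEquiv G.1 (2 * G.1 + 1) v) :=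
  iff_of_eq (congrArg₂ (starDigraph G.2 (T G.1)).Adj
    ((starEquiv _ _).symm_apply_apply u).symm ((starEquiv _ _).symm_apply_apply v).symm)

theorem digraphIso_star (T : (n : ℕ) → Digraph (Fin (2 * n + 1))) (G : FinDigraph) :
    DigraphIso (starDigraph G.2 (T G.1)) (star T G).2 :=
  ⟨starEquiv _ _, starDigraph_adj_iff T G⟩

theorem DigraphIso.starDigraph {V V' W : Type} {G : Digraph V} {H : Digraph V'} (T : Digraph W)
    (h : DigraphIso G H) : DigraphIso (starDigraph G T) (starDigraph H T) := by
  obtain ⟨φ, h⟩ := h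
  refine ⟨⟨fun x => match x with
      | .left u => .left (φ u)
      | .right u => .right (φ u)
      | .tour t => .tour t,
    fun x => match x with
      | .left u => .left (φ.symm u)
      | .right u => .right (φ.symm u)
      | .tour t => .tour t, ?_, ?_⟩, ?_⟩
  · rintro (u | u | t) <;> simp
  · rintro (u | u | t) <;> simp
  · rintro (u | u | s) (v | v | t) <;> simp [OCliqueGI.starDigraph, StarAdj, h]

/-- The number of the vertices to which there is an arc from `v`. -/
noncomputable def outDegree {V : Type} (G : Digraph V) (v : V) : ℕ := {w | G.Adj v w}.ncard

theorem outDegree_map {V W : Type} {G : Digraph V} {H : Digraph W} (φ : V ≃ W)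
    (h : ∀ u v, G.Adj u v ↔ H.Adj (φ u) (φ v)) (v : V) : outDegree H (φ v) = outDegree G v := by
  have : {w | H.Adj (φ v) w} = φ '' {w | G.Adj v w} := by
    ext w
    obtain ⟨w, rfl⟩ := φ.surjective w
    simp [h]
  rw [outDegree, this, Set.ncard_image_of_injective _ φ.injective, outDegree]

instance (n m : ℕ) : Finite (StarVertex (Fin n) (Fin m)) := Finite.of_equiv _ (starEquiv n m).symm

theorem lt_outDegree_left {n : ℕ} (G : Digraph (Fin n)) (T : Digraph (Fin (2 * n + 1)))
    (u : Fin n) : 2 * n < outDegree (starDigraph G T) (.left u) := by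
  have h1 : Set.range StarVertex.tour ⊆ {w | (starDigraph G T).Adj (.left u) w} := by
    rintro _ ⟨t, rfl⟩
    trivial
  have h2 := Set.ncard_le_ncard h1 (Set.toFinite _)
  have h3 : (Set.range (StarVertex.tour : Fin (2 * n + 1) → StarVertex (Fin n) _)).ncard =
      2 * n + 1 := by
    rw [← Set.image_univ, Set.ncard_image_of_injective _ fun _ _ h => StarVertex.tour.inj h,
      Set.ncard_univ, Nat.card_eq_fintype_card, Fintype.card_fin]
  unfold outDegree
  omega

theorem ncard_fin_le {n : ℕ} (s : Set (Fin n)) : s.ncard ≤ n := by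
  simpa [Set.ncard_univ] using Set.ncard_le_ncard (Set.subset_univ s)

theorem outDegree_right_le {n : ℕ} (G : Digraph (Fin n)) (T : Digraph (Fin (2 * n + 1)))
    (u : Fin n) : outDegree (starDigraph G T) (.right u) ≤ 2 * n := by
  have h1 : {w | (starDigraph G T).Adj (.right u) w} ⊆
      StarVertex.left '' Set.univ ∪ StarVertex.right '' Set.univ := by
    rintro (v | v | t) h
    · simp
    · simp
    · exact h.elim
  have h2 := Set.ncard_le_ncard h1 (Set.toFinite _)
  have h3 := Set.ncard_union_le (StarVertex.left '' (Set.univ : Set (Fin n)))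
    (StarVertex.right '' Set.univ : Set (StarVertex (Fin n) (Fin (2 * n + 1))))
  rw [Set.ncard_image_of_injective _ fun _ _ h => StarVertex.left.inj h,
    Set.ncard_image_of_injective _ fun _ _ h => StarVertex.right.inj h] at h3
  have h4 := ncard_fin_le (Set.univ : Set (Fin n))
  unfold outDegree
  omega

/-- Here regularity matters: in- and out-neighbourhood of `t` are disjoint, of the same size `d`,
and avoid `t`, so `2d ≤ 2n`. The `n` right vertices bring the total to at most `2n`. -/
theorem outDegree_tour_le {n : ℕ} (G : Digraph (Fin n)) {T : Digraph (Fin (2 * n + 1))}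
    (hT : IsRegularTournament T) (t : Fin (2 * n + 1)) :
    outDegree (starDigraph G T) (.tour t) ≤ 2 * n := by
  obtain ⟨d, hd⟩ := hT.2.2
  have hd1 : d + d ≤ 2 * n := by
    have h1 : Disjoint {w | T.Adj t w} {w | T.Adj w t} :=
      Set.disjoint_left.2 fun w hw hw' => hT.1 _ _ hw hw'
    have h2 := Set.ncard_union_eq h1
    rw [(hd t).1, (hd t).2] at h2
    have h3 : t ∉ {w | T.Adj t w} ∪ {w | T.Adj w t} := by
      rintro (h | h) <;> exact hT.1 _ _ h h
    have h4 := Set.ncard_insert_of_notMem h3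
    have h5 := ncard_fin_le (insert t ({w | T.Adj t w} ∪ {w | T.Adj w t}))
    omega
  have h1 : {w | (starDigraph G T).Adj (.tour t) w} ⊆
      StarVertex.tour '' {w | T.Adj t w} ∪ StarVertex.right '' Set.univ := by
    rintro (v | v | s) h
    · exact h.elim
    · simp
    · exact Or.inl ⟨s, h, rfl⟩
  have h2 := Set.ncard_le_ncard h1 (Set.toFinite _)
  have h3 := Set.ncard_union_le (StarVertex.tour '' {w | T.Adj t w})
    (StarVertex.right '' Set.univ : Set (StarVertex (Fin n) (Fin (2 * n + 1))))
  rw [Set.ncard_image_of_injective _ fun _ _ h => StarVertex.tour.inj h,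
    Set.ncard_image_of_injective _ fun _ _ h => StarVertex.right.inj h, (hd t).1] at h3
  have h4 := ncard_fin_le (Set.univ : Set (Fin n))
  unfold outDegree
  omega

/-- Out-degree above `2n` characterises the left copy, so the isomorphism restricts to an injection
of left copies, which is bijective by finiteness. -/
theorem digraphIso_of_starDigraph {n : ℕ} {G H : Digraph (Fin n)} {T : Digraph (Fin (2 * n + 1))}
    (hT : IsRegularTournament T) (h : DigraphIso (starDigraph G T) (starDigraph H T)) :
    DigraphIso G H := by
  obtain ⟨φ, h⟩ := h
  have key : ∀ u, ∃ v, φ (.left u) = .left v := by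
    intro u
    have h1 := lt_outDegree_left G T u
    rw [← outDegree_map φ h] at h1
    match hx : φ (.left u) with
    | .left v => exact ⟨v, rfl⟩
    | .right v => exact absurd (outDegree_right_le H T v) (by rw [hx] at h1; omega)
    | .tour t => exact absurd (outDegree_tour_le H hT t) (by rw [hx] at h1; omega)
  choose f hf using key
  refine digraphIso_of_injective f (fun u v huv => ?_) fun u v => ?_
  · have : φ (.left u) = φ (.left v) := by rw [hf, hf, huv]
    exact StarVertex.left.inj (φ.injective this)
  · have := h (.left u) (.left v)
    rwa [hf, hf] at this

theorem isOrientedClique_star {T : (n : ℕ) → Digraph (Fin (2 * n + 1))}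
    (hT : ∀ n, IsRegularTournament (T n)) {G : FinDigraph} (hG : IsDAG G.2) :
    IsOrientedClique (star T G).2 :=
  (digraphIso_star T G).isOrientedClique
    (isOrientedClique_starDigraph hG.isOrientedGraph (hT G.1))

theorem digraphIso_iff_star {T : (n : ℕ) → Digraph (Fin (2 * n + 1))}
    (hT : ∀ n, IsRegularTournament (T n)) (G H : FinDigraph) :
    DigraphIso G.2 H.2 ↔ DigraphIso (star T G).2 (star T H).2 := by
  obtain ⟨n, G⟩ := G
  obtain ⟨m, H⟩ := H
  constructor
  · intro h
    obtain rfl := h.card_eq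
    exact (digraphIso_star T ⟨n, G⟩).symm.trans ((h.starDigraph (T n)).trans
      (digraphIso_star T ⟨n, H⟩))
  · intro h
    -- The orders are `4n + 1` and `4m + 1`; their equality makes the two tournaments the same.
    have hnm : n = m := by
      have := h.card_eq
      simp only [star] at this
      omega
    subst hnm
    exact digraphIso_of_starDigraph (hT n) ((digraphIso_star T ⟨n, G⟩).trans
      (h.trans (digraphIso_star T ⟨n, H⟩).symm))

/-! ### The rotational tournaments -/

/-- The tournament on `{0, …, 2n}` with the arcs from `i` to `i + 1, …, i + n` modulo `2n + 1`. -/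
def rotTournament (n : ℕ) : Digraph (Fin (2 * n + 1)) where
  Adj i j := (i.val < j.val ∧ j.val ≤ i.val + n) ∨ j.val + n < i.val

theorem ncard_fin_eq {N k : ℕ} {p : ℕ → Prop} (s : Finset ℕ) (hs : s.card = k)
    (h : ∀ x, x ∈ s ↔ x < N ∧ p x) : {w : Fin N | p w}.ncard = k := by
  have h1 : (Fin.val '' {w : Fin N | p w}) = (s : Set ℕ) := by
    ext x
    simp only [Set.mem_image, Set.mem_ofPred_eq, Finset.mem_coe, h]
    exact ⟨by rintro ⟨w, hw, rfl⟩; exact ⟨w.2, hw⟩, fun hx => ⟨⟨x, hx.1⟩, hx.2, rfl⟩⟩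
  rw [← Set.ncard_image_of_injective _ Fin.val_injective, h1, Set.ncard_coe_finset, hs]

theorem isRegularTournament_rotTournament (n : ℕ) : IsRegularTournament (rotTournament n) := by
  refine ⟨fun u v h1 h2 => ?_, fun u v h => ?_, n, fun v => ⟨?_, ?_⟩⟩
  · simp only [rotTournament] at h1 h2
    omega
  · have := Fin.val_ne_of_ne h
    simp only [rotTournament]
    omega
  · have hv := v.2
    refine ncard_fin_eq (p := fun w => (v.val < w ∧ w ≤ v.val + n) ∨ w + n < v.val)
      -- The out-neighbours reached without and with wrapping around; truncated subtraction makes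
      -- the second set empty for `v ≤ n`.
      (Finset.Ioc v.val (min (v.val + n) (2 * n)) ∪ Finset.range (v.val - n)) ?_ ?_
    · rw [Finset.card_union_of_disjoint]
      · simp; omega
      · rw [Finset.disjoint_left]
        intro x
        simp only [Finset.mem_Ioc, Finset.mem_range]
        omega
    · intro x
      simp only [Finset.mem_Ioc, Finset.mem_range, Finset.mem_union]
      omega
  · have hv := v.2
    refine ncard_fin_eq (p := fun w => (w < v.val ∧ v.val ≤ w + n) ∨ v.val + n < w)
      (Finset.Ico (v.val - n) v.val ∪ Finset.Ioc (v.val + n) (2 * n)) ?_ ?_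
    · rw [Finset.card_union_of_disjoint]
      · simp; omega
      · rw [Finset.disjoint_left]
        intro x
        simp only [Finset.mem_Ioc, Finset.mem_Ico]
        omega
    · intro x
      simp only [Finset.mem_Ioc, Finset.mem_Ico, Finset.mem_union]
      omega

/-! ### The construction `G⋆` as a block rule -/

/-- The block rule for `G⋆` with the rotational tournaments. -/
def starRule : BlockRule where
  blocks := 4
  entry
    | 0, 0, a, _, _, _ => a
    | 1, 1, a, _, _, _ => a
    | 0, 1, _, _, lt, gt => !lt && !gt
    | 1, 0, _, _, lt, gt => lt || gt
    | 0, _, _, _, _, _ => true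
    | 1, _, _, _, _, _ => false
    | _, 0, _, _, _, _ => false
    | _, 1, _, _, _, _ => true
    | 2, 3, _, _, lt, _ => !lt
    | 3, 2, _, _, _, gt => gt
    | _, _, _, _, lt, _ => lt
  toExtra b := b == 0 || b == 3
  fromExtra c := c == 1 || c == 2

/-- Blocks 0 and 1 are the two copies, blocks 2 and 3 the tournament vertices below `n` and from `n`
to `2n - 1`, and the tournament vertex `2n` is the extra one. -/
theorem starVertex_cases {n : ℕ} (x : StarVertex (Fin n) (Fin (2 * n + 1))) :
    (∃ u, x = .left u ∧ (starEquiv n (2 * n + 1) x).val = 0 * n + u) ∨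
    (∃ u, x = .right u ∧ (starEquiv n (2 * n + 1) x).val = 1 * n + u) ∨
    (∃ t : Fin (2 * n + 1), ∃ u : Fin n, x = .tour t ∧ t.val = u ∧
      (starEquiv n (2 * n + 1) x).val = 2 * n + u) ∨
    (∃ t : Fin (2 * n + 1), ∃ u : Fin n, x = .tour t ∧ t.val = n + u ∧
      (starEquiv n (2 * n + 1) x).val = 3 * n + u) ∨
    (∃ t : Fin (2 * n + 1), x = .tour t ∧ t.val = 2 * n ∧
      (starEquiv n (2 * n + 1) x).val = 4 * n) := by
  rcases x with u | u | t
  · exact Or.inl ⟨u, rfl, by simp [starEquiv]⟩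
  · exact Or.inr (Or.inl ⟨u, rfl, by simp [starEquiv]⟩)
  · have ht : (starEquiv n (2 * n + 1) (.tour t)).val = n + (n + t) := by simp [starEquiv]
    have := t.2
    rw [ht]
    rcases lt_or_ge t.val n with h | h
    · exact Or.inr (Or.inr (Or.inl ⟨t, ⟨t, h⟩, rfl, rfl, by simp; omega⟩))
    · rcases lt_or_ge t.val (2 * n) with h' | h'
      · exact Or.inr (Or.inr (Or.inr (Or.inl ⟨t, ⟨t - n, by omega⟩, rfl, by simp; omega,
          by simp; omega⟩)))
      · exact Or.inr (Or.inr (Or.inr (Or.inr ⟨t, rfl, by omega, by omega⟩)))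

/-- The tournament entries come from the offsets `u`, `v` within a block: `u → n + v` is an arc iff
`v ≤ u`, `n + u → v` wraps around and is an arc iff `v < u`, and inside one block the arcs go
upwards. -/
theorem starRule_transforms (G : FinDigraph) :
    starRule.Transforms G.2.Adj (star rotTournament G).2.Adj := by
  obtain ⟨n, G⟩ := G
  refine ⟨by simp only [star, starRule]; omega, fun x y => ?_⟩
  obtain ⟨x, rfl⟩ := (starEquiv n (2 * n + 1)).surjective x
  obtain ⟨y, rfl⟩ := (starEquiv n (2 * n + 1)).surjective y
  have h1 : (star rotTournament ⟨n, G⟩).2.Adj (starEquiv n (2 * n + 1) x)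
      (starEquiv n (2 * n + 1) y) ↔ StarAdj G (rotTournament n) x y :=
    (starDigraph_adj_iff rotTournament ⟨n, G⟩ x y).symm
  have hb : ∀ (b c : ℕ) (u v : Fin n), b < 4 → c < 4 →
      starRule.matrix n (natMatrix G.Adj) (b * n + u) (c * n + v) =
        starRule.entry b c (natMatrix G.Adj u v) (natMatrix G.Adj v u) (decide (u.val < v.val))
          (decide (v.val < u.val)) :=
    fun b c u v hb hc => BlockRule.matrix_block hb hc u.2 v.2
  have ht : ∀ (b : ℕ) (u : Fin n), b < 4 →
      starRule.matrix n (natMatrix G.Adj) (b * n + u) (4 * n) = starRule.toExtra b :=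
    fun b u hb => BlockRule.matrix_toExtra (B := starRule) hb u.2
  have hf : ∀ (c : ℕ) (u : Fin n), c < 4 →
      starRule.matrix n (natMatrix G.Adj) (4 * n) (c * n + u) = starRule.fromExtra c :=
    fun c u hc => BlockRule.matrix_fromExtra (B := starRule) hc u.2
  have he : starRule.matrix n (natMatrix G.Adj) (4 * n) (4 * n) = false :=
    BlockRule.matrix_extra (B := starRule)
  refine h1.trans ?_
  rcases starVertex_cases x with ⟨u, rfl, hx⟩ | ⟨u, rfl, hx⟩ | ⟨s, u, rfl, hs, hx⟩ |
      ⟨s, u, rfl, hs, hx⟩ | ⟨s, rfl, hs, hx⟩ <;>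
    rcases starVertex_cases y with ⟨v, rfl, hy⟩ | ⟨v, rfl, hy⟩ | ⟨t, v, rfl, ht', hy⟩ |
      ⟨t, v, rfl, ht', hy⟩ | ⟨t, rfl, ht', hy⟩ <;>
    rw [hx, hy] <;>
    (first | rw [hb _ _ _ _ (by decide) (by decide)] | rw [ht _ _ (by decide)] |
      rw [hf _ _ (by decide)] | rw [he]) <;>
    simp [StarAdj, starRule, natMatrix_eq_true, rotTournament, Fin.ext_iff, *] <;> omega

/-! ### Compositions of block rules -/

/-- The composition of a block rule with a construction that replaces an `n × n` matrix by
`k × k` blocks of size `n × n`. -/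
def BlockRule.comp (B : BlockRule) (k : ℕ) (φ : ℕ → ℕ → Bool → Bool → Bool → Bool → Bool) :
    BlockRule where
  blocks := B.blocks * k
  entry b c a a' lt gt := B.entry (b / k) (c / k) (φ (b % k) (c % k) a a' lt gt)
    (φ (c % k) (b % k) a' a gt lt) (decide (b % k < c % k) || (b % k == c % k && lt))
    (decide (c % k < b % k) || (b % k == c % k && gt))
  toExtra b := B.toExtra (b / k)
  fromExtra c := B.fromExtra (c / k)

/-- Lexicographic comparison of block number and offset; it expresses the order of indices of the
intermediate matrix in terms of the original one. -/
theorem lt_iff_div_mod {n : ℕ} (hn : 0 < n) (a b : ℕ) :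
    a < b ↔ a / n < b / n ∨ (a / n = b / n ∧ a % n < b % n) := by
  have h1 := Nat.div_add_mod a n
  have h2 := Nat.div_add_mod b n
  have h3 := Nat.mod_lt a hn
  have h4 := Nat.mod_lt b hn
  constructor
  · intro h
    have := Nat.div_le_div_right (c := n) h.le
    rcases this.lt_or_eq with h5 | h5
    · exact Or.inl h5
    · rw [h5] at h1
      exact Or.inr ⟨h5, by omega⟩
  · rintro (h | ⟨h, h'⟩)
    · by_contra hab
      have := Nat.div_le_div_right (c := n) (not_lt.1 hab)
      omega
    · rw [h] at h1
      omega

/-- A block of size `k * n` splits into `k` blocks of size `n`: the outer block of `x` is `x / n /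
k`, the inner one `x / n % k`, and the offset `x % n`. -/
theorem BlockRule.matrix_comp (B : BlockRule) {k : ℕ}
    {φ : ℕ → ℕ → Bool → Bool → Bool → Bool → Bool} {n : ℕ} {A A' : ℕ → ℕ → Bool}
    (h : ∀ x < k * n, ∀ y < k * n, A' x y = φ (x / n) (y / n) (A (x % n) (y % n))
      (A (y % n) (x % n)) (decide (x % n < y % n)) (decide (y % n < x % n))) (x y : ℕ) :
    B.matrix (k * n) A' x y = (B.comp k φ).matrix n A x y := by
  -- If `k * n = 0`, only the extra entry is left, and the division identities are not needed.
  rcases Nat.eq_zero_or_pos (k * n) with h0 | h0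
  · simp [matrix, BlockRule.comp, mul_assoc, h0]
  have hn : 0 < n := Nat.pos_of_mul_pos_left h0
  have hd : ∀ x, x / (k * n) = x / n / k := fun x => by
    rw [mul_comm, Nat.div_div_eq_div_mul]
  have hmd : ∀ x, x % (k * n) / n = x / n % k := fun x => by
    rw [mul_comm, Nat.mod_mul_right_div_self]
  have hmm : ∀ x, x % (k * n) % n = x % n := fun x => Nat.mod_mul_left_mod x k n
  have hl : ∀ x y, decide (x % (k * n) < y % (k * n)) =
      (decide (x / n % k < y / n % k) ||
        (x / n % k == y / n % k && decide (x % n < y % n))) := by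
    intro x y
    rw [Bool.eq_iff_iff]
    simp [lt_iff_div_mod hn (x % (k * n)), hmd, hmm]
  have hl' : ∀ x y, decide (y % (k * n) < x % (k * n)) =
      (decide (y / n % k < x / n % k) ||
        (x / n % k == y / n % k && decide (y % n < x % n))) := by
    intro x y
    rw [hl, Bool.beq_comm]
  simp only [matrix, BlockRule.comp, mul_assoc, hd, hl, h _ (Nat.mod_lt _ h0) _ (Nat.mod_lt _ h0),
    hmd, hmm]
  congr! 5
  rw [Bool.beq_comm]

/-! ### Graphs and directed acyclic graphs -/

/-- The vertices of the directed acyclic graph made from a graph. -/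
inductive LayerVertex (V : Type) : Type
  | source (u : V)
  | middle (u : V)
  | sink (u : V)

/-- The adjacency relation of the directed acyclic graph made from the relation `r`. -/
def LayerAdj {V : Type} (r : V → V → Prop) : LayerVertex V → LayerVertex V → Prop
  | .source u, .middle v => u = v
  | .middle u, .sink v => u = v
  | .source u, .sink v => r u v
  | _, _ => False

def layerDigraph {V : Type} (r : V → V → Prop) : Digraph (LayerVertex V) where
  Adj := LayerAdj r

/-- Every arc raises the number of the layer. -/
theorem isDAG_layerDigraph {V : Type} (r : V → V → Prop) : IsDAG (layerDigraph r) := by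
  let f : LayerVertex V → ℕ
    | .source _ => 0
    | .middle _ => 1
    | .sink _ => 2
  intro v hv
  have h : Relation.TransGen (· < ·) (f v) (f v) := by
    refine hv.lift f ?_
    rintro (u | u | u) (v | v | v) h <;> first | exact h.elim | simp [f, Function.onFun]
  rw [Relation.transGen_eq_self] at h
  exact lt_irrefl _ h

theorem digraphIso_layerDigraph {V W : Type} {r : V → V → Prop} {s : W → W → Prop} (φ : V ≃ W)
    (h : ∀ u v, r u v ↔ s (φ u) (φ v)) : DigraphIso (layerDigraph r) (layerDigraph s) := by
  refine ⟨⟨fun x => match x with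
      | .source u => .source (φ u)
      | .middle u => .middle (φ u)
      | .sink u => .sink (φ u),
    fun x => match x with
      | .source u => .source (φ.symm u)
      | .middle u => .middle (φ.symm u)
      | .sink u => .sink (φ.symm u), ?_, ?_⟩, ?_⟩
  · rintro (u | u | u) <;> simp
  · rintro (u | u | u) <;> simp
  · rintro (u | u | u) (v | v | v) <;> simp [layerDigraph, LayerAdj, h]

/-- Only middle vertices have both an incoming and an outgoing arc, so the path `source u → middle u
→ sink u` goes to the corresponding path of a single vertex `v`. -/
theorem exists_injective_of_layerDigraph {V W : Type} {r : V → V → Prop} {s : W → W → Prop}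
    (h : DigraphIso (layerDigraph r) (layerDigraph s)) :
    ∃ f : V → W, Function.Injective f ∧ ∀ u v, r u v ↔ s (f u) (f v) := by
  obtain ⟨φ, h⟩ := h
  have key : ∀ u, ∃ v, φ (.source u) = .source v ∧ φ (.middle u) = .middle v ∧
      φ (.sink u) = .sink v := by
    intro u
    have h1 := (h (.source u) (.middle u)).1 rfl
    have h2 := (h (.middle u) (.sink u)).1 rfl
    revert h1 h2
    rcases φ (.source u) with a | a | a <;> rcases φ (.middle u) with b | b | b <;>
      rcases φ (.sink u) with c | c | c <;> simp [layerDigraph, LayerAdj]; grind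
  choose f h1 h2 h3 using key
  refine ⟨f, fun u v huv => ?_, fun u v => ?_⟩
  · have : φ (.middle u) = φ (.middle v) := by rw [h2, h2, huv]
    exact LayerVertex.middle.inj (φ.injective this)
  · have := h (.source u) (.sink v)
    rwa [h1, h3] at this

/-- The numbering of the vertices of the directed acyclic graph. -/
def layerEquiv (n : ℕ) : LayerVertex (Fin n) ≃ Fin (3 * n) :=
  Equiv.trans
    { toFun := fun x => match x with
        | .source u => (0, u)
        | .middle u => (1, u)
        | .sink u => (2, u)
      invFun := fun x => match x with
        | (0, u) => .source u
        | (1, u) => .middle u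
        | (2, u) => .sink u
      left_inv := by rintro (u | u | u) <;> rfl
      right_inv := by rintro ⟨b, u⟩; fin_cases b <;> rfl }
    finProdFinEquiv

/-- The directed acyclic graph made from a graph on `n` vertices. -/
def layerFinDigraph {n : ℕ} (r : Fin n → Fin n → Prop) : FinDigraph :=
  ⟨3 * n, { Adj := fun x y => LayerAdj r ((layerEquiv n).symm x) ((layerEquiv n).symm y) }⟩

theorem digraphIso_layerFinDigraph {n : ℕ} (r : Fin n → Fin n → Prop) :
    DigraphIso (layerDigraph r) (layerFinDigraph r).2 :=
  ⟨layerEquiv n, fun u v => iff_of_eq (congrArg₂ (LayerAdj r)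
    ((layerEquiv n).symm_apply_apply u).symm ((layerEquiv n).symm_apply_apply v).symm)⟩

theorem DigraphIso.isDAG {V W : Type} {G : Digraph V} {H : Digraph W} (h : DigraphIso G H)
    (hG : IsDAG G) : IsDAG H := by
  obtain ⟨φ, h⟩ := h.symm
  exact fun v hv => hG (φ v) (hv.lift φ fun a b hab => (h a b).1 hab)

/-- The entries of the adjacency matrix of the directed acyclic graph. -/
def layerEntry : ℕ → ℕ → Bool → Bool → Bool → Bool → Bool
  | 0, 1, _, _, lt, gt => !lt && !gt
  | 1, 2, _, _, lt, gt => !lt && !gt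
  | 0, 2, a, _, _, _ => a
  | _, _, _, _, _, _ => false

theorem layerVertex_cases {n : ℕ} (x : LayerVertex (Fin n)) :
    (∃ u, x = .source u ∧ (layerEquiv n x).val = 0 * n + u) ∨
    (∃ u, x = .middle u ∧ (layerEquiv n x).val = 1 * n + u) ∨
    (∃ u, x = .sink u ∧ (layerEquiv n x).val = 2 * n + u) := by
  rcases x with u | u | u <;> simp [layerEquiv, finProdFinEquiv] <;> omega

theorem natMatrix_layerFinDigraph {n : ℕ} (r : Fin n → Fin n → Prop) (x : ℕ) (hx : x < 3 * n)
    (y : ℕ) (hy : y < 3 * n) : natMatrix (layerFinDigraph r).2.Adj x y =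
      layerEntry (x / n) (y / n) (natMatrix r (x % n) (y % n)) (natMatrix r (y % n) (x % n))
        (decide (x % n < y % n)) (decide (y % n < x % n)) := by
  obtain ⟨x', hx'⟩ := (layerEquiv n).surjective ⟨x, hx⟩
  obtain ⟨y', hy'⟩ := (layerEquiv n).surjective ⟨y, hy⟩
  have ex : x = (layerEquiv n x').val := by rw [hx']
  have ey : y = (layerEquiv n y').val := by rw [hy']
  have h1 : natMatrix (layerFinDigraph r).2.Adj x y = true ↔ LayerAdj r x' y' := by
    rw [ex, ey]
    refine (natMatrix_eq_true (layerFinDigraph r).2.Adj _ _).trans ?_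
    simp [layerFinDigraph]
  rw [Bool.eq_iff_iff, h1, ex, ey]
  rcases layerVertex_cases x' with ⟨u, rfl, hu⟩ | ⟨u, rfl, hu⟩ | ⟨u, rfl, hu⟩ <;>
    rcases layerVertex_cases y' with ⟨v, rfl, hv⟩ | ⟨v, rfl, hv⟩ | ⟨v, rfl, hv⟩ <;>
    rw [hu, hv, BlockRule.mul_add_div_of_lt u.2, BlockRule.mul_add_div_of_lt v.2,
      BlockRule.mul_add_mod_of_lt' u.2, BlockRule.mul_add_mod_of_lt' v.2] <;>
    simp [LayerAdj, layerEntry, natMatrix_eq_true, Fin.ext_iff] <;> omega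

theorem starRule_comp_transforms {n : ℕ} (r : Fin n → Fin n → Prop) :
    (starRule.comp 3 layerEntry).Transforms r
      (star rotTournament (layerFinDigraph r)).2.Adj := by
  obtain ⟨h1, h2⟩ := starRule_transforms (layerFinDigraph r)
  refine ⟨?_, fun x y => ?_⟩
  · rw [h1]
    simp only [BlockRule.comp, layerFinDigraph, mul_assoc]
  · rw [h2]
    exact iff_of_eq (congrArg (· = true)
      (starRule.matrix_comp (natMatrix_layerFinDigraph r) x y))

/-! ### Directed graphs and simple graphs -/

/-- The vertices of the simple graph made from a directed graph. -/
inductive GadgetVertex (V : Type) : Type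
  | tail (u : V)
  | head (u : V)
  | mid (u : V)
  | apex (u : V)
  | apex' (u : V)
  | leaf (u : V)
  | isolated

/-- The adjacency relation of the simple graph made from the relation `r`: an arc from `u` to `v`
becomes an edge between `tail u` and `head v`; the vertex `mid u` links `tail u` with `head u` and
lies on a triangle with `apex u` and `apex' u`; a leaf is attached to `tail u`. -/
def GadgetAdj {V : Type} (r : V → V → Prop) : GadgetVertex V → GadgetVertex V → Prop
  | .tail u, .head v => r u v
  | .head u, .tail v => r v u
  | .mid u, .tail v | .tail u, .mid v | .mid u, .head v | .head u, .mid v => u = v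
  | .mid u, .apex v | .apex u, .mid v | .mid u, .apex' v | .apex' u, .mid v => u = v
  | .apex u, .apex' v | .apex' u, .apex v => u = v
  | .leaf u, .tail v | .tail u, .leaf v => u = v
  | _, _ => False

theorem GadgetAdj.symm {V : Type} {r : V → V → Prop} : ∀ {x y : GadgetVertex V},
    GadgetAdj r x y → GadgetAdj r y x := by
  rintro (u | u | u | u | u | u | _) (v | v | v | v | v | v | _) h <;>
    simp_all [GadgetAdj]

theorem not_gadgetAdj_self {V : Type} (r : V → V → Prop) (x : GadgetVertex V) :
    ¬ GadgetAdj r x x := by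
  rcases x with u | u | u | u | u | u | _ <;> simp [GadgetAdj]

/-! ### Kinds of gadget vertices, described by adjacency alone. -/

section Invariants

variable {α β : Type} (R : α → α → Prop)

/-- `x` lies on a triangle. -/
def OnTriangle (x : α) : Prop := ∃ y z, R x y ∧ R y z ∧ R z x

/-- No neighbour of `x` lies on a triangle. -/
def FarFromTriangles (x : α) : Prop := ∀ y, R x y → ¬ OnTriangle R y

/-- In the gadget graph only leaves and the isolated vertex are far from triangles, and only tails
have a leaf as neighbour. -/
def IsTailLike (x : α) : Prop := ∃ y, FarFromTriangles R y ∧ R x y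

/-- The apices lie on triangles too, but are not adjacent to tails. -/
def IsMidLike (x : α) : Prop := OnTriangle R x ∧ ∃ y, IsTailLike R y ∧ R x y

/-- A `mid` vertex is adjacent to its tail, its head and its two apices; the two negations leave
only the head. -/
def IsHeadLike (x : α) : Prop :=
  ¬ OnTriangle R x ∧ ¬ IsTailLike R x ∧ ∃ y, IsMidLike R y ∧ R x y

variable {R} {R' : β → β → Prop} (ψ : α ≃ β) (h : ∀ x y, R x y ↔ R' (ψ x) (ψ y))

include h

theorem onTriangle_map (x : α) : OnTriangle R' (ψ x) ↔ OnTriangle R x := by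
  simp [OnTriangle, h, ψ.surjective.exists]

theorem farFromTriangles_map (x : α) : FarFromTriangles R' (ψ x) ↔ FarFromTriangles R x := by
  simp [FarFromTriangles, h, ψ.surjective.forall, onTriangle_map ψ h]

theorem isTailLike_map (x : α) : IsTailLike R' (ψ x) ↔ IsTailLike R x := by
  simp [IsTailLike, h, ψ.surjective.exists, farFromTriangles_map ψ h]

theorem isMidLike_map (x : α) : IsMidLike R' (ψ x) ↔ IsMidLike R x := by
  simp [IsMidLike, h, ψ.surjective.exists, onTriangle_map ψ h, isTailLike_map ψ h]

theorem isHeadLike_map (x : α) : IsHeadLike R' (ψ x) ↔ IsHeadLike R x := by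
  simp [IsHeadLike, h, ψ.surjective.exists, onTriangle_map ψ h, isTailLike_map ψ h,
    isMidLike_map ψ h]

end Invariants

section Gadget

variable {V W : Type} {r : V → V → Prop}

/-- A further triangle could only be `tail u`, `mid u`, `head u`, which requires a loop at `u`; this
is what `hr` excludes. -/
theorem onTriangle_gadget (hr : ∀ u, ¬ r u u) (x : GadgetVertex V) :
    OnTriangle (GadgetAdj r) x ↔ ∃ u, x = .mid u ∨ x = .apex u ∨ x = .apex' u := by
  constructor
  · rintro ⟨y, z, h1, h2, h3⟩
    rcases x with u | u | u | u | u | u | _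
    · rcases y with v | v | v | v | v | v | _ <;> rcases z with w | w | w | w | w | w | _ <;>
        simp_all [GadgetAdj]
    · rcases y with v | v | v | v | v | v | _ <;> rcases z with w | w | w | w | w | w | _ <;>
        simp_all [GadgetAdj]
    · exact ⟨u, by simp⟩
    · exact ⟨u, by simp⟩
    · exact ⟨u, by simp⟩
    · rcases y with v | v | v | v | v | v | _ <;> rcases z with w | w | w | w | w | w | _ <;>
        simp_all [GadgetAdj]
    · rcases y with v | v | v | v | v | v | _ <;> simp_all [GadgetAdj]
  · rintro ⟨u, rfl | rfl | rfl⟩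
    · exact ⟨.apex u, .apex' u, rfl, rfl, rfl⟩
    · exact ⟨.mid u, .apex' u, rfl, rfl, rfl⟩
    · exact ⟨.mid u, .apex u, rfl, rfl, rfl⟩

theorem farFromTriangles_gadget (hr : ∀ u, ¬ r u u) (x : GadgetVertex V) :
    FarFromTriangles (GadgetAdj r) x ↔ x = .isolated ∨ ∃ u, x = .leaf u := by
  constructor
  · intro h
    rcases x with u | u | u | u | u | u | _
    · exact (h (.mid u) rfl ((onTriangle_gadget hr _).2 ⟨u, by simp⟩)).elim
    · exact (h (.mid u) rfl ((onTriangle_gadget hr _).2 ⟨u, by simp⟩)).elim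
    · exact (h (.apex u) rfl ((onTriangle_gadget hr _).2 ⟨u, by simp⟩)).elim
    · exact (h (.mid u) rfl ((onTriangle_gadget hr _).2 ⟨u, by simp⟩)).elim
    · exact (h (.mid u) rfl ((onTriangle_gadget hr _).2 ⟨u, by simp⟩)).elim
    · exact Or.inr ⟨u, rfl⟩
    · exact Or.inl rfl
  · rintro (rfl | ⟨u, rfl⟩) (v | v | v | v | v | v | _) h <;>
      simp_all [GadgetAdj, onTriangle_gadget hr]

theorem isTailLike_gadget (hr : ∀ u, ¬ r u u) (x : GadgetVertex V) :
    IsTailLike (GadgetAdj r) x ↔ ∃ u, x = .tail u := by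
  constructor
  · rintro ⟨y, hy, h⟩
    rcases (farFromTriangles_gadget hr y).1 hy with rfl | ⟨v, rfl⟩ <;>
      rcases x with u | u | u | u | u | u | _ <;> simp_all [GadgetAdj]
  · rintro ⟨u, rfl⟩
    exact ⟨.leaf u, (farFromTriangles_gadget hr _).2 (Or.inr ⟨u, rfl⟩), rfl⟩

theorem isMidLike_gadget (hr : ∀ u, ¬ r u u) (x : GadgetVertex V) :
    IsMidLike (GadgetAdj r) x ↔ ∃ u, x = .mid u := by
  constructor
  · rintro ⟨h1, y, hy, h⟩
    obtain ⟨v, rfl⟩ := (isTailLike_gadget hr y).1 hy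
    obtain ⟨u, rfl | rfl | rfl⟩ := (onTriangle_gadget hr x).1 h1
    · exact ⟨u, rfl⟩
    · exact h.elim
    · exact h.elim
  · rintro ⟨u, rfl⟩
    exact ⟨(onTriangle_gadget hr _).2 ⟨u, by simp⟩, .tail u,
      (isTailLike_gadget hr _).2 ⟨u, rfl⟩, rfl⟩

theorem isHeadLike_gadget (hr : ∀ u, ¬ r u u) (x : GadgetVertex V) :
    IsHeadLike (GadgetAdj r) x ↔ ∃ u, x = .head u := by
  simp only [IsHeadLike, onTriangle_gadget hr, isTailLike_gadget hr, isMidLike_gadget hr]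
  constructor
  · rintro ⟨h1, h2, y, ⟨v, rfl⟩, h⟩
    rcases x with u | u | u | u | u | u | _ <;> simp_all [GadgetAdj]
  · rintro ⟨u, rfl⟩
    exact ⟨by simp, by simp, .mid u, ⟨u, rfl⟩, rfl⟩

/-- The isomorphism preserves the kinds `mid`, `tail` and `head`; adjacency to `mid u` forces the
images of `tail u` and `head u` to have the same index as that of `mid u`. -/
theorem exists_injective_of_gadget {s : W → W → Prop} (hr : ∀ u, ¬ r u u) (hs : ∀ u, ¬ s u u)
    (ψ : GadgetVertex V ≃ GadgetVertex W)
    (h : ∀ x y, GadgetAdj r x y ↔ GadgetAdj s (ψ x) (ψ y)) :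
    ∃ f : V → W, Function.Injective f ∧ ∀ u v, r u v ↔ s (f u) (f v) := by
  have key : ∀ u, ∃ v, ψ (.mid u) = .mid v ∧ ψ (.tail u) = .tail v ∧ ψ (.head u) = .head v := by
    intro u
    obtain ⟨a, ha⟩ := (isMidLike_gadget hs _).1
      ((isMidLike_map ψ h _).2 ((isMidLike_gadget hr (.mid u)).2 ⟨u, rfl⟩))
    obtain ⟨b, hb⟩ := (isTailLike_gadget hs _).1
      ((isTailLike_map ψ h _).2 ((isTailLike_gadget hr (.tail u)).2 ⟨u, rfl⟩))
    obtain ⟨c, hc⟩ := (isHeadLike_gadget hs _).1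
      ((isHeadLike_map ψ h _).2 ((isHeadLike_gadget hr (.head u)).2 ⟨u, rfl⟩))
    have h1 := (h (.mid u) (.tail u)).1 rfl
    have h2 := (h (.mid u) (.head u)).1 rfl
    rw [ha, hb] at h1
    rw [ha, hc] at h2
    have hab : a = b := h1
    have hac : a = c := h2
    exact ⟨a, ha, hab ▸ hb, hac ▸ hc⟩
  choose f h1 h2 h3 using key
  refine ⟨f, fun u v huv => ?_, fun u v => ?_⟩
  · have : ψ (.mid u) = ψ (.mid v) := by rw [h1, h1, huv]
    exact GadgetVertex.mid.inj (ψ.injective this)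
  · have := h (.tail u) (.head v)
    rwa [h2, h3] at this

theorem exists_equiv_gadget {s : W → W → Prop} (φ : V ≃ W) (h : ∀ u v, r u v ↔ s (φ u) (φ v)) :
    ∃ ψ : GadgetVertex V ≃ GadgetVertex W, ∀ x y, GadgetAdj r x y ↔
      GadgetAdj s (ψ x) (ψ y) := by
  refine ⟨⟨fun x => match x with
      | .tail u => .tail (φ u)
      | .head u => .head (φ u)
      | .mid u => .mid (φ u)
      | .apex u => .apex (φ u)
      | .apex' u => .apex' (φ u)
      | .leaf u => .leaf (φ u)
      | .isolated => .isolated,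
    fun x => match x with
      | .tail u => .tail (φ.symm u)
      | .head u => .head (φ.symm u)
      | .mid u => .mid (φ.symm u)
      | .apex u => .apex (φ.symm u)
      | .apex' u => .apex' (φ.symm u)
      | .leaf u => .leaf (φ.symm u)
      | .isolated => .isolated, ?_, ?_⟩, ?_⟩
  · rintro (u | u | u | u | u | u | _) <;> simp
  · rintro (u | u | u | u | u | u | _) <;> simp
  · rintro (u | u | u | u | u | u | _) (v | v | v | v | v | v | _) <;> simp [GadgetAdj, h]

end Gadget

/-- The numbering of the vertices of the simple graph. -/
def gadgetEquiv (n : ℕ) : GadgetVertex (Fin n) ≃ Fin (6 * n + 1) :=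
  Equiv.trans
    { toFun := fun x => match x with
        | .tail u => Sum.inl (0, u)
        | .head u => Sum.inl (1, u)
        | .mid u => Sum.inl (2, u)
        | .apex u => Sum.inl (3, u)
        | .apex' u => Sum.inl (4, u)
        | .leaf u => Sum.inl (5, u)
        | .isolated => Sum.inr 0
      invFun := fun x => match x with
        | Sum.inl (0, u) => .tail u
        | Sum.inl (1, u) => .head u
        | Sum.inl (2, u) => .mid u
        | Sum.inl (3, u) => .apex u
        | Sum.inl (4, u) => .apex' u
        | Sum.inl (5, u) => .leaf u
        | Sum.inr _ => .isolated
      left_inv := by rintro (u | u | u | u | u | u | _) <;> rfl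
      right_inv := by
        rintro (⟨b, u⟩ | b)
        · fin_cases b <;> rfl
        · fin_cases b; rfl }
    ((finProdFinEquiv.sumCongr (Equiv.refl (Fin 1))).trans finSumFinEquiv)

/-- The simple graph made from a directed graph on `n` vertices. -/
def gadgetGraph {n : ℕ} (r : Fin n → Fin n → Prop) : FinGraph :=
  ⟨6 * n + 1,
    { Adj := fun x y => GadgetAdj r ((gadgetEquiv n).symm x) ((gadgetEquiv n).symm y)
      symm := ⟨fun _ _ h => h.symm⟩
      loopless := ⟨fun _ => not_gadgetAdj_self r _⟩ }⟩

/-- The block rule for the simple graph made from a directed graph. -/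
def gadgetRule : BlockRule where
  blocks := 6
  entry
    | 0, 1, a, _, _, _ => a
    | 1, 0, _, a', _, _ => a'
    | 2, 0, _, _, lt, gt | 0, 2, _, _, lt, gt | 2, 1, _, _, lt, gt | 1, 2, _, _, lt, gt =>
      !lt && !gt
    | 2, 3, _, _, lt, gt | 3, 2, _, _, lt, gt | 2, 4, _, _, lt, gt | 4, 2, _, _, lt, gt =>
      !lt && !gt
    | 3, 4, _, _, lt, gt | 4, 3, _, _, lt, gt => !lt && !gt
    | 5, 0, _, _, lt, gt | 0, 5, _, _, lt, gt => !lt && !gt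
    | _, _, _, _, _, _ => false
  toExtra _ := false
  fromExtra _ := false

/-- The isolated vertex fills the extra row and column that every block rule adds. -/
theorem gadgetVertex_cases {n : ℕ} (x : GadgetVertex (Fin n)) :
    (∃ u, x = .tail u ∧ (gadgetEquiv n x).val = 0 * n + u) ∨
    (∃ u, x = .head u ∧ (gadgetEquiv n x).val = 1 * n + u) ∨
    (∃ u, x = .mid u ∧ (gadgetEquiv n x).val = 2 * n + u) ∨
    (∃ u, x = .apex u ∧ (gadgetEquiv n x).val = 3 * n + u) ∨
    (∃ u, x = .apex' u ∧ (gadgetEquiv n x).val = 4 * n + u) ∨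
    (∃ u, x = .leaf u ∧ (gadgetEquiv n x).val = 5 * n + u) ∨
    (x = .isolated ∧ (gadgetEquiv n x).val = 6 * n) := by
  rcases x with u | u | u | u | u | u | _ <;> simp [gadgetEquiv, finProdFinEquiv] <;> omega

theorem gadgetRule_transforms {n : ℕ} (r : Fin n → Fin n → Prop) :
    gadgetRule.Transforms r (gadgetGraph r).2.Adj := by
  refine ⟨rfl, fun x y => ?_⟩
  obtain ⟨x, rfl⟩ := (gadgetEquiv n).surjective x
  obtain ⟨y, rfl⟩ := (gadgetEquiv n).surjective y
  have h1 : (gadgetGraph r).2.Adj (gadgetEquiv n x) (gadgetEquiv n y) ↔ GadgetAdj r x y :=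
    iff_of_eq (congrArg₂ (GadgetAdj r)
      ((gadgetEquiv n).symm_apply_apply x) ((gadgetEquiv n).symm_apply_apply y))
  have hb : ∀ (b c : ℕ) (u v : Fin n), b < 6 → c < 6 →
      gadgetRule.matrix n (natMatrix r) (b * n + u) (c * n + v) =
        gadgetRule.entry b c (natMatrix r u v) (natMatrix r v u) (decide (u.val < v.val))
          (decide (v.val < u.val)) :=
    fun b c u v hb hc => BlockRule.matrix_block hb hc u.2 v.2
  have ht : ∀ (b : ℕ) (u : Fin n), b < 6 →
      gadgetRule.matrix n (natMatrix r) (b * n + u) (6 * n) = gadgetRule.toExtra b :=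
    fun b u hb => BlockRule.matrix_toExtra (B := gadgetRule) hb u.2
  have hf : ∀ (c : ℕ) (u : Fin n), c < 6 →
      gadgetRule.matrix n (natMatrix r) (6 * n) (c * n + u) = gadgetRule.fromExtra c :=
    fun c u hc => BlockRule.matrix_fromExtra (B := gadgetRule) hc u.2
  have he : gadgetRule.matrix n (natMatrix r) (6 * n) (6 * n) = false :=
    BlockRule.matrix_extra (B := gadgetRule)
  -- The rule expresses equality of offsets by two negated comparisons.
  have heq : ∀ u v : Fin n, u = v ↔ u.val ≤ v.val ∧ v.val ≤ u.val :=
    fun u v => by rw [Fin.ext_iff]; omega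
  refine h1.trans ?_
  rcases gadgetVertex_cases x with ⟨u, rfl, hx⟩ | ⟨u, rfl, hx⟩ | ⟨u, rfl, hx⟩ | ⟨u, rfl, hx⟩ |
      ⟨u, rfl, hx⟩ | ⟨u, rfl, hx⟩ | ⟨rfl, hx⟩ <;>
    rcases gadgetVertex_cases y with ⟨v, rfl, hy⟩ | ⟨v, rfl, hy⟩ | ⟨v, rfl, hy⟩ | ⟨v, rfl, hy⟩ |
      ⟨v, rfl, hy⟩ | ⟨v, rfl, hy⟩ | ⟨rfl, hy⟩ <;>
    -- If both vertices are isolated, `hx` has already rewritten both indices.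
    rw [hx] <;> (try rw [hy]) <;>
    (first | rw [hb _ _ _ _ (by decide) (by decide)] | rw [ht _ _ (by decide)] |
      rw [hf _ _ (by decide)] | rw [he]) <;>
    simp [GadgetAdj, gadgetRule, natMatrix_eq_true, heq, and_comm]

theorem digraphIso_iff_gadgetGraph (G H : FinDigraph) (hG : ∀ u, ¬ G.2.Adj u u)
    (hH : ∀ u, ¬ H.2.Adj u u) :
    DigraphIso G.2 H.2 ↔ Nonempty ((gadgetGraph G.2.Adj).2 ≃g (gadgetGraph H.2.Adj).2) := by
  obtain ⟨n, G⟩ := G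
  obtain ⟨m, H⟩ := H
  constructor
  · rintro ⟨φ, h⟩
    obtain ⟨ψ, hψ⟩ := exists_equiv_gadget φ h
    exact ⟨⟨(gadgetEquiv n).symm.trans (ψ.trans (gadgetEquiv m)), fun {x y} =>
      Iff.trans (iff_of_eq (congrArg₂ (GadgetAdj H.Adj) ((gadgetEquiv m).symm_apply_apply _)
        ((gadgetEquiv m).symm_apply_apply _))) (hψ _ _).symm⟩⟩
  · rintro ⟨e⟩
    have hnm : n = m := by
      have e' : Fin (6 * n + 1) ≃ Fin (6 * m + 1) := e.toEquiv
      simpa using Fintype.card_congr e'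
    subst hnm
    obtain ⟨f, hf, h⟩ := exists_injective_of_gadget hG hH
      ((gadgetEquiv n).trans (e.toEquiv.trans (gadgetEquiv n).symm)) (by
        intro x y
        have := e.map_rel_iff (a := gadgetEquiv n x) (b := gadgetEquiv n y)
        simp only [gadgetGraph, Equiv.symm_apply_apply] at this
        exact this.symm)
    exact digraphIso_of_injective f hf h

theorem nonempty_iso_iff_layerFinDigraph (G H : FinGraph) : Nonempty (G.2 ≃g H.2) ↔
    DigraphIso (layerFinDigraph G.2.Adj).2 (layerFinDigraph H.2.Adj).2 := by
  obtain ⟨n, G⟩ := G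
  obtain ⟨m, H⟩ := H
  constructor
  · rintro ⟨e⟩
    exact (digraphIso_layerFinDigraph _).symm.trans ((digraphIso_layerDigraph e.toEquiv
      fun u v => e.map_rel_iff.symm).trans (digraphIso_layerFinDigraph _))
  · intro h
    have hnm : n = m := by
      have := h.card_eq
      simp only [layerFinDigraph] at this
      omega
    subst hnm
    obtain ⟨f, hf, h⟩ := exists_injective_of_layerDigraph ((digraphIso_layerFinDigraph _).trans
      (h.trans (digraphIso_layerFinDigraph _).symm))
    exact ⟨⟨Equiv.ofBijective f (Finite.injective_iff_bijective.1 hf), fun {u v} => (h u v).symm⟩⟩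

/-! ### The reductions -/

/-- The reduction of DAGISO to OCLIQUEISO. -/
def starReduction (p : dagIso.Instance) : ocliqueIso.Instance :=
  (⟨star rotTournament p.1.1, isOrientedClique_star isRegularTournament_rotTournament p.1.2⟩,
    ⟨star rotTournament p.2.1, isOrientedClique_star isRegularTournament_rotTournament p.2.2⟩)

theorem isPolyTimeReduction_starReduction :
    IsPolyTimeReduction dagIso ocliqueIso starReduction :=
  ⟨starRule.computableInPolyTime_of_transforms _ _ _ fun p =>
    ⟨_, _, _, _, _, _, _, _, rfl, rfl, starRule_transforms p.1.1, starRule_transforms p.2.1⟩,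
    fun p => digraphIso_iff_star isRegularTournament_rotTournament p.1.1 p.2.1⟩

theorem isDAG_layerFinDigraph {n : ℕ} (r : Fin n → Fin n → Prop) :
    IsDAG (layerFinDigraph r).2 :=
  (digraphIso_layerFinDigraph r).isDAG (isDAG_layerDigraph r)

/-- The reduction of the graph isomorphism problem to OCLIQUEISO. -/
def graphToOclique (p : graphIso.Instance) : ocliqueIso.Instance :=
  (⟨star rotTournament (layerFinDigraph p.1.2.Adj),
      isOrientedClique_star isRegularTournament_rotTournament (isDAG_layerFinDigraph _)⟩,
    ⟨star rotTournament (layerFinDigraph p.2.2.Adj),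
      isOrientedClique_star isRegularTournament_rotTournament (isDAG_layerFinDigraph _)⟩)

/-- The map factors through acyclic digraphs, which settles the equivalence of the answers, while
the composed rule computes it in one pass. -/
theorem isPolyTimeReduction_graphToOclique :
    IsPolyTimeReduction graphIso ocliqueIso graphToOclique :=
  ⟨(starRule.comp 3 layerEntry).computableInPolyTime_of_transforms _ _ _ fun p =>
    ⟨_, _, _, _, _, _, _, _, rfl, rfl, starRule_comp_transforms p.1.2.Adj,
      starRule_comp_transforms p.2.2.Adj⟩,
    fun p => (nonempty_iso_iff_layerFinDigraph p.1 p.2).trans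
      (digraphIso_iff_star isRegularTournament_rotTournament _ _)⟩

/-- The reduction of OCLIQUEISO to the graph isomorphism problem. -/
def ocliqueToGraph (p : ocliqueIso.Instance) : graphIso.Instance :=
  (gadgetGraph p.1.1.2.Adj, gadgetGraph p.2.1.2.Adj)

theorem isPolyTimeReduction_ocliqueToGraph :
    IsPolyTimeReduction ocliqueIso graphIso ocliqueToGraph :=
  ⟨gadgetRule.computableInPolyTime_of_transforms _ _ _ fun p =>
    ⟨_, _, _, _, _, _, _, _, rfl, rfl, gadgetRule_transforms p.1.1.2.Adj,
      gadgetRule_transforms p.2.1.2.Adj⟩,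
    fun p => digraphIso_iff_gadgetGraph p.1.1 p.2.1 (fun u h => p.1.2.1 u u h h)
      (fun u h => p.2.2.1 u u h h)⟩

end OCliqueGI

theorem mainTheorem6 :
    OCliqueGI.IsGIComplete OCliqueGI.ocliqueIso ∧
    -- the construction is correct, for every choice of the regular tournaments
    (∀ T : (n : ℕ) → Digraph (Fin (2 * n + 1)), (∀ n, OCliqueGI.IsRegularTournament (T n)) →
      ∀ G H : OCliqueGI.FinDigraph, OCliqueGI.IsDAG G.2 → OCliqueGI.IsDAG H.2 →
        OCliqueGI.IsOrientedClique (OCliqueGI.star T G).2 ∧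
        OCliqueGI.IsOrientedClique (OCliqueGI.star T H).2 ∧
        (OCliqueGI.DigraphIso G.2 H.2 ↔
          OCliqueGI.DigraphIso (OCliqueGI.star T G).2 (OCliqueGI.star T H).2)) ∧
    -- for a suitable choice it is a polynomial-time reduction of DAGISO to OCLIQUEISO
    (∃ T : (n : ℕ) → Digraph (Fin (2 * n + 1)), (∀ n, OCliqueGI.IsRegularTournament (T n)) ∧
      ∃ f : OCliqueGI.dagIso.Instance → OCliqueGI.ocliqueIso.Instance,
        OCliqueGI.IsPolyTimeReduction OCliqueGI.dagIso OCliqueGI.ocliqueIso f ∧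
        ∀ p : OCliqueGI.dagIso.Instance,
          (f p).1.1 = OCliqueGI.star T p.1.1 ∧ (f p).2.1 = OCliqueGI.star T p.2.1) :=

  ⟨⟨⟨_, OCliqueGI.isPolyTimeReduction_ocliqueToGraph⟩,
      _, OCliqueGI.isPolyTimeReduction_graphToOclique⟩,
    fun _ hT G H hG hH => ⟨OCliqueGI.isOrientedClique_star hT hG,
      OCliqueGI.isOrientedClique_star hT hH, OCliqueGI.digraphIso_iff_star hT G H⟩,
    OCliqueGI.rotTournament, OCliqueGI.isRegularTournament_rotTournament,
    OCliqueGI.starReduction, OCliqueGI.isPolyTimeReduction_starReduction, fun _ => ⟨rfl, rfl⟩⟩
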